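/- Let $\Delta_2$ be the full subcategory of the simplex category on the ordered sets $[0],[1],[2]$, regarded as a locally discrete 2-category, and let $W_i:\Delta_2\to\mathrm{Cat}$ be the weight for reflexive codescent objects, that is, the composite $$\Delta_2\hookrightarrow \mathrm{Cat}\xrightarrow{\ \text{reflection}\ }\mathrm{Gpd}\hookrightarrow\mathrm{Cat},$$ where the first functor regards an ordered set as a category, the second sends a category to the free groupoid on it, and $\mathrm{Cat}$ (resp. $\mathrm{Gpd}$) is the category of small categories (resp. groupoids). For a small 2-category $\mathcal J$, a weight $W:\mathcal J\to\mathrm{Cat}$ is called * *sifted* if finite products commute with $W$-weighted colimits in $\mathrm{Cat}$, i.e. if the functor $W\star -:[\mathcal J^{op},\mathrm{Cat}]\to\mathrm{Cat}$ preserves finite products, where $W\star D$ is the weighted colimit, defined by isomorphisms of categories $\mathrm{Cat}(W\star D,A)\cong[\mathcal J,\mathrm{Cat}](W,\mathrm{Cat}(D-,A))$; * *flexible* if the counit $q_W:QW\to W$ has a section in $[\mathcal J,\mathrm{Cat}]$, where $Q$ is the left adjoint to the inclusion of $[\mathcal J,\mathrm{Cat}]$ (2-functors, 2-natural transformations, modifications)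 in $\mathrm{Ps}(\mathcal J,\mathrm{Cat})$ (2-functors, pseudonatural transformations, modifications). **Proposition (Lack).** Reflexive codescent objects are sifted flexible colimits: the weight $W_i$ is both sifted and flexible. -/

import Mathlib

open CategoryTheory CategoryTheory.Limits Opposite

universe w w' u

namespace WeightedColimits

/-! Throughout, `J` is a (small) category, regarded as a locally discrete 2-category.  Thus a
2-functor `J ⟶ Cat`, that is, a `J`-indexed *weight*, is an ordinary functor `W : J ⥤ Cat`, and a
2-natural transformation between two weights is an ordinary natural transformation. -/

section TwoCategories

variable {J : Type w} [Category.{w'} J]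

/-- A functor between two (possibly large) categories is an isomorphism of categories:
it is fully faithful and bijective on objects. -/
structure IsIsoOfCategories {C : Type*} {D : Type*} [Category C] [Category D] (F : C ⥤ D) :
    Prop where
  full : F.Full
  faithful : F.Faithful
  bijective_obj : Function.Bijective F.obj

/-- A pseudonatural transformation between weights: a family of functors `app j : W j ⥤ X j` with
natural isomorphisms `coh f : W f ⋙ app k ≅ app j ⋙ X f` for the arrows `f : j ⟶ k` of `J`,
compatible with identities and composition.  (The arrows given by `eqToHom` are identities between
objects that are equal because `W` and `X` preserve identities and composition.) -/
structure Pseudonatural (W X : J ⥤ Cat.{u, u}) where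
  /-- The components. -/
  app (j : J) : W.obj j ⥤ X.obj j
  /-- The invertible coherence 2-cells. -/
  coh {j k : J} (f : j ⟶ k) : (W.map f).toFunctor ⋙ app k ≅ app j ⋙ (X.map f).toFunctor
  coh_id (j : J) (x : W.obj j) :
    (coh (𝟙 j)).hom.app x = eqToHom (by simp)
  coh_comp {i j k : J} (f : i ⟶ j) (g : j ⟶ k) (x : W.obj i) :
    (coh (f ≫ g)).hom.app x =
      eqToHom (by simp) ≫ (coh g).hom.app ((W.map f).toFunctor.obj x) ≫
        (X.map g).toFunctor.map ((coh f).hom.app x) ≫ eqToHom (by simp)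

/-- A modification between pseudonatural transformations. -/
@[ext]
structure Modification {W X : J ⥤ Cat.{u, u}} (α β : Pseudonatural W X) where
  /-- The components. -/
  app (j : J) : α.app j ⟶ β.app j
  naturality {j k : J} (f : j ⟶ k) (x : W.obj j) :
    (app k).app ((W.map f).toFunctor.obj x) ≫ (β.coh f).hom.app x =
      (α.coh f).hom.app x ≫ (X.map f).toFunctor.map ((app j).app x)

/-- The hom-category `Ps(J, Cat)(W, X)` of pseudonatural transformations and modifications. -/
instance (W X : J ⥤ Cat.{u, u}) : Category (Pseudonatural W X) where
  Hom α β := Modification α β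
  id α :=
    { app := fun j => 𝟙 (α.app j)
      naturality := fun f x => by simp }
  comp m n :=
    { app := fun j => m.app j ≫ n.app j
      naturality := fun f x => by
        rw [NatTrans.comp_app, NatTrans.comp_app, Functor.map_comp, Category.assoc,
          n.naturality, ← Category.assoc, m.naturality, Category.assoc] }
  id_comp m := Modification.ext (funext fun j => Category.id_comp (m.app j))
  comp_id m := Modification.ext (funext fun j => Category.comp_id (m.app j))
  assoc m n o := Modification.ext (funext fun j => Category.assoc (m.app j) (n.app j) (o.app j))

/-- The identity pseudonatural transformation. -/
def Pseudonatural.id (W : J ⥤ Cat.{u, u}) : Pseudonatural W W where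
  app j := 𝟭 (W.obj j)
  coh f := Iso.refl (W.map f).toFunctor
  coh_id _ _ := rfl
  coh_comp f g x := by simp

/-- The composite of two pseudonatural transformations. -/
def Pseudonatural.comp {W X Y : J ⥤ Cat.{u, u}} (α : Pseudonatural W X)
    (β : Pseudonatural X Y) : Pseudonatural W Y where
  app j := α.app j ⋙ β.app j
  coh {j k} f :=
    NatIso.ofComponents
      (fun x => (β.app k).mapIso ((α.coh f).app x) ≪≫ (β.coh f).app ((α.app j).obj x))
      (fun {x y} m => by
        have h := (α.coh f).hom.naturality m
        have h' := (β.coh f).hom.naturality ((α.app j).map m)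
        simp only [Functor.comp_map] at h h'
        simp only [Functor.comp_map, Iso.trans_hom, Functor.mapIso_hom, Iso.app_hom,
          Category.assoc]
        rw [← Category.assoc, ← Functor.map_comp, h, Functor.map_comp, Category.assoc, h'])
  coh_id j x := by
    simp [α.coh_id, β.coh_id, eqToHom_map]
  coh_comp {i j k} f g x := by
    have h := (β.coh g).hom.naturality ((α.coh f).hom.app x)
    simp only [Functor.comp_map] at h
    simp [α.coh_comp, β.coh_comp, eqToHom_map]
    rw [reassoc_of% h]

/-- The inclusion of `[J, Cat]` in `Ps(J, Cat)` on arrows: a 2-natural transformation is a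
pseudonatural transformation whose coherence 2-cells are identities. -/
def toPseudonatural {W X : J ⥤ Cat.{u, u}} (α : W ⟶ X) : Pseudonatural W X where
  app j := (α.app j).toFunctor
  coh f := eqToIso (congrArg Cat.Hom.toFunctor (α.naturality f))
  coh_id j x := by simp [eqToHom_app]
  coh_comp f g x := by simp [eqToHom_app, eqToHom_map]

/-- The hom-category `[J, Cat](W, X)`: its objects are the 2-natural transformations `W ⟶ X` and
its morphisms are the modifications between them. -/
abbrev TwoNatural (W X : J ⥤ Cat.{u, u}) :=
  InducedCategory (Pseudonatural W X) (toPseudonatural (W := W) (X := X))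

/-- The functor `[J, Cat](Q, X) ⥤ Ps(J, Cat)(W, X)` given by composition with a pseudonatural
transformation `p` from `W` to `Q`. -/
def precompPseudonatural {W Q : J ⥤ Cat.{u, u}} (p : Pseudonatural W Q) (X : J ⥤ Cat.{u, u}) :
    TwoNatural Q X ⥤ Pseudonatural W X where
  obj α := p.comp (toPseudonatural α)
  map m :=
    { app := fun j => (p.app j).whiskerLeft (m.hom.app j)
      naturality := fun {j k} f x => by
        have h := (m.hom.app k).naturality ((p.coh f).hom.app x)
        have h' := m.hom.naturality f ((p.app j).obj x)
        refine (Category.assoc _ _ _).symm.trans (Eq.trans ?_ (Category.assoc _ _ _).symm)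
        refine Eq.trans ?_ (congrArg (_ ≫ ·) h')
        exact (congrArg (· ≫ _) h.symm).trans (Category.assoc _ _ _) }
  map_id _ := rfl
  map_comp _ _ := rfl

/-- A pseudonatural transformation `p` from `W` to `Q` exhibits `Q` as the pseudomorphism
classifier `QW` of the weight `W`, that is, as the value at `W` of the left adjoint to the
inclusion of `[J, Cat]` in `Ps(J, Cat)`, with unit `p`. -/
def IsPseudomorphismClassifier {W Q : J ⥤ Cat.{u, u}} (p : Pseudonatural W Q) : Prop :=
  ∀ X : J ⥤ Cat.{u, u}, IsIsoOfCategories (precompPseudonatural p X)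

/-- A weight `W` is flexible if its pseudomorphism classifier `QW` is such that the counit
`q : QW ⟶ W`, the unique 2-natural transformation whose composite with the unit is the identity
of `W`, admits a section in `[J, Cat]`. -/
def IsFlexible (W : J ⥤ Cat.{u, u}) : Prop :=
  ∃ (Q : J ⥤ Cat.{u, u}) (p : Pseudonatural W Q) (q : Q ⟶ W),
    IsPseudomorphismClassifier p ∧ p.comp (toPseudonatural q) = Pseudonatural.id W ∧
      ∃ s : W ⟶ Q, s ≫ q = 𝟙 W

/-- The weight `Cat(D-, A)` obtained from a diagram `D : Jᵒᵖ ⥤ Cat` and a category `A`; its value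
at `j` is the category of functors from `D j` to `A`. -/
def homInto (D : Jᵒᵖ ⥤ Cat.{u, u}) (A : Cat.{u, u}) : J ⥤ Cat.{u, u} where
  obj j := Cat.of (D.obj (op j) ⥤ A)
  map f := ((Functor.whiskeringLeft _ _ A).obj (D.map f.op).toFunctor).toCatHom
  map_id j := by
    ext : 1
    have h := congrArg Cat.Hom.toFunctor (D.map_id (op j))
    exact congrArg (fun F => (Functor.whiskeringLeft _ _ A).obj F) h
  map_comp f g := by
    ext : 1
    simp only [op_comp, Functor.map_comp]
    rfl

/-- The 2-natural transformation `Cat(D-, g)` induced by a functor `g`. -/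
def homIntoMap (D : Jᵒᵖ ⥤ Cat.{u, u}) {A B : Cat.{u, u}} (g : A ⥤ B) :
    homInto D A ⟶ homInto D B where
  app j := ((Functor.whiskeringRight (D.obj (op j)) A B).obj g).toCatHom
  naturality _ _ _ := rfl

/-- The 2-natural transformation `Cat(φ-, A)` induced by a morphism of diagrams `φ`. -/
def homIntoPre {D E : Jᵒᵖ ⥤ Cat.{u, u}} (φ : D ⟶ E) (A : Cat.{u, u}) :
    homInto E A ⟶ homInto D A where
  app j := ((Functor.whiskeringLeft _ _ A).obj (φ.app (op j)).toFunctor).toCatHom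
  naturality j k f := by
    have h := congrArg Cat.Hom.toFunctor (φ.naturality f.op)
    ext : 1
    exact (congrArg (fun F => (Functor.whiskeringLeft _ _ A).obj F) h).symm

/-- The functor `Cat(L, A) ⥤ [J, Cat](W, Cat(D-, A))` induced by a cocone
`c : W ⟶ Cat(D-, L)`. -/
def cocomparison {W : J ⥤ Cat.{u, u}} {D : Jᵒᵖ ⥤ Cat.{u, u}} {L : Cat.{u, u}}
    (c : W ⟶ homInto D L) (A : Cat.{u, u}) : (L ⥤ A) ⥤ TwoNatural W (homInto D A) where
  obj g := c ≫ homIntoMap D g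
  map β := InducedCategory.homMk
    { app := fun j =>
        (c.app j).toFunctor.whiskerLeft ((Functor.whiskeringRight (D.obj (op j)) L A).map β)
      naturality := fun {j k} f x => by
        simp only [toPseudonatural, eqToIso.hom, eqToHom_app]
        refine NatTrans.ext (funext fun y => ?_)
        have e := congrArg (fun F => (F.toFunctor.obj x).obj y) (c.naturality f)
        refine (congrArg (_ ≫ ·) (eqToHom_app _ _)).trans
          (Eq.trans ?_ (congrArg (· ≫ _) (eqToHom_app _ _)).symm)
        exact eqToHom_naturality β.app e }
  map_id _ := rfl
  map_comp _ _ := rfl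

/-- A cocone `c : W ⟶ Cat(D-, L)` exhibits the category `L` as the colimit in `Cat` of the diagram
`D` weighted by `W`. -/
def IsWeightedColimit {W : J ⥤ Cat.{u, u}} {D : Jᵒᵖ ⥤ Cat.{u, u}} {L : Cat.{u, u}}
    (c : W ⟶ homInto D L) : Prop :=
  ∀ A : Cat.{u, u}, IsIsoOfCategories (cocomparison c A)

/-- A functor `W ⋆ - : [Jᵒᵖ, Cat] ⥤ Cat` sending each diagram to a colimit of it weighted by `W`,
and acting on morphisms of diagrams in the way determined by the universal property. -/
structure WeightedColimitFunctor (W : J ⥤ Cat.{u, u}) where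
  /-- The functor `W ⋆ -`. -/
  functor : (Jᵒᵖ ⥤ Cat.{u, u}) ⥤ Cat.{u, u}
  /-- The colimit cocones. -/
  cocone (D : Jᵒᵖ ⥤ Cat.{u, u}) : W ⟶ homInto D (functor.obj D)
  isWeightedColimit (D : Jᵒᵖ ⥤ Cat.{u, u}) : IsWeightedColimit (cocone D)
  naturality {D E : Jᵒᵖ ⥤ Cat.{u, u}} (φ : D ⟶ E) :
    cocone D ≫ homIntoMap D (functor.map φ).toFunctor = cocone E ≫ homIntoPre φ (functor.obj E)

/-- A weight `W` is sifted if finite products commute with `W`-weighted colimits in `Cat`: such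
colimits exist, and the functor `W ⋆ - : [Jᵒᵖ, Cat] ⥤ Cat` preserves finite products.  This functor
is determined up to unique isomorphism, and a 2-functor between these 2-categories preserves finite
products exactly when its underlying functor does. -/
def IsSifted (W : J ⥤ Cat.{u, u}) : Prop :=
  ∃ T : WeightedColimitFunctor W, PreservesFiniteProducts T.functor

end TwoCategories

section Codescent

/-- The weight `Δ₂ ⥤ Cat` for reflexive lax codescent objects: the embedding in `Cat` of the full
subcategory `Δ₂` of the simplex category on the ordered sets `[0]`, `[1]`, `[2]`. -/
def reflexiveLaxCodescentWeight : SimplexCategory.Truncated 2 ⥤ Cat.{u, u} :=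
  SimplexCategory.Truncated.inclusion 2 ⋙ SimplexCategory.toPartOrd.{u} ⋙
    forget₂ PartOrd.{u} Preord.{u} ⋙ preordToCat.{u}

/-- The weight `Δ₂ ⥤ Cat` for reflexive codescent objects: the weight for reflexive lax codescent
objects, followed by the reflection of categories into groupoids and the inclusion of groupoids in
categories. -/
noncomputable def reflexiveCodescentWeight : SimplexCategory.Truncated 2 ⥤ Cat.{u, u} :=
  reflexiveLaxCodescentWeight.{u} ⋙ Grpd.free.{u} ⋙ Grpd.forgetToCat.{u, u}

end Codescent

end WeightedColimits

/-! Everything rests on two properties of the weight `W`, collected in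
`IsIndiscretelyRepresentedBy`: each `W[n]` is indiscrete, because `[n]` has an initial object, and
its objects are the points `[0] ⟶ [n]`, so the presheaf of objects of `W` is representable.

Flexibility. For a weight with thin values, `QW` is explicit: the objects of `QW j` are formal pairs
of an arrow `f : i ⟶ j` and an object `x` of `W i`, and their morphisms are those of `W j` between
the images `W f x`. A section of the counit must choose such a pair over each object strictly
naturally. Representability supplies the choice: an object of `W j` is `W f x₀` for a unique `f : j₀
⟶ j`.

Siftedness. A `W`-weighted cocone under `D` amounts to a functor out of `D[0]` together with
coherent 2-cells indexed by pairs of points of `[n]` and objects of `D[n]`. The colimit is therefore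
a category presented by generators and relations, `CodescentCat`. To see that it preserves binary
products, a morphism is lifted from either factor by using degenerate simplices in the other factor.
The inverse of the comparison functor composes two such lifts, and it is a functor as soon as lifts
from different factors commute (`SimplicialFrame.left_comp_right`). For a pair of edges, this is the
division of a square into two triangles with a common diagonal. Edges suffice because any two points
of `[n]` are joined by an edge in some direction, and reversed edges act as inverses. The terminal
diagram is handled separately: all its cells are degenerate, hence identities. -/

namespace CategoryTheory.FreeGroupoid

/-! ### Free groupoids on categories with an initial object -/

variable {C : Type u} [Category.{u} C]

/-- In the free groupoid on a category with an initial object `a`, every morphism is determined by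
the morphisms coming from `a`. -/
theorem homMk_to_comp {a : C} (ha : IsInitial a) {x y : C} (m : mk x ⟶ mk y) :
    homMk (ha.to x) ≫ m = homMk (ha.to y) := by
  -- The arrows out of `a` form a natural isomorphism from a constant functor to the inclusion of
  -- `C`. It extends to the free groupoid, where naturality at `m` is the claim, since the constant
  -- functor sends `m` to an identity.
  let τ : of C ⋙ (Functor.const (FreeGroupoid C)).obj (mk a) ≅ of C ⋙ 𝟭 (FreeGroupoid C) :=
    NatIso.ofComponents (fun x => asIso (homMk (ha.to x)))
      (fun {x y} f => by
        have h : ha.to y = ha.to x ≫ f := ha.hom_ext _ _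
        change 𝟙 _ ≫ (of C).map (ha.to y) = (of C).map (ha.to x) ≫ (of C).map f
        rw [Category.id_comp, h, Functor.map_comp])
  have h := (liftNatIso _ _ τ).hom.naturality m
  have hx : (liftNatIso _ _ τ).hom.app (mk x) = homMk (ha.to x) := liftNatIso_hom_app ..
  have hy : (liftNatIso _ _ τ).hom.app (mk y) = homMk (ha.to y) := liftNatIso_hom_app ..
  rw [hx, hy] at h
  exact h.symm.trans (Category.id_comp _)

/-- The free groupoid on a category with an initial object is indiscrete. -/
theorem nonempty_unique_hom {a : C} (ha : IsInitial a) (x y : FreeGroupoid C) :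
    Nonempty (Unique (x ⟶ y)) := by
  obtain ⟨x, rfl⟩ := of_obj_bijective.2 x
  obtain ⟨y, rfl⟩ := of_obj_bijective.2 y
  exact
    ⟨{ default := Groupoid.inv (homMk (ha.to x)) ≫ homMk (ha.to y)
       uniq m := by
         rw [← homMk_to_comp ha m, ← Category.assoc, Groupoid.inv_comp, Category.id_comp] }⟩

end CategoryTheory.FreeGroupoid

/-! ### Indiscreteness and representability of the weight for reflexive codescent objects -/

namespace WeightedColimits

/-- A weight `W` is indiscretely represented by an object `x₀` of `W j₀` if every `W j` is
indiscrete and `x₀` represents the presheaf of objects of `W`. -/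
structure IsIndiscretelyRepresentedBy {J : Type} [Category.{0} J] (W : J ⥤ Cat.{u, u}) {j₀ : J}
    (x₀ : W.obj j₀) : Prop where
  bijective (j : J) : Function.Bijective fun f : j₀ ⟶ j => (W.map f).toFunctor.obj x₀
  unique_hom (j : J) (x y : W.obj j) : Nonempty (Unique (x ⟶ y))

section Simplices

open SimplexCategory Simplicial

/-- The object `[n]` of `Δ₂`. -/
abbrev truncatedMk (n : ℕ) (h : n ≤ 2) : SimplexCategory.Truncated 2 := ⟨⦋n⦌, h⟩

/-- The point of `[n]` given by one of its elements. -/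
def simplexPoint (j : SimplexCategory.Truncated 2) (i : Fin (j.obj.len + 1)) :
    truncatedMk 0 (by decide) ⟶ j :=
  ObjectProperty.homMk (SimplexCategory.const ⦋0⦌ j.obj i)

theorem simplexPoint_surjective {j : SimplexCategory.Truncated 2}
    (f : truncatedMk 0 (by decide) ⟶ j) : ∃ i, f = simplexPoint j i :=
  ⟨f.hom.toOrderHom 0, ObjectProperty.hom_ext _ (SimplexCategory.eq_const_of_zero f.hom)⟩

theorem simplexPoint_comp {j k : SimplexCategory.Truncated 2} (i : Fin (j.obj.len + 1))
    (h : j ⟶ k) : simplexPoint j i ≫ h = simplexPoint k (h.hom.toOrderHom i) :=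
  ObjectProperty.hom_ext _ (SimplexCategory.const_comp _ _ _)

theorem truncated_hom_ext_zero {j : SimplexCategory.Truncated 2}
    (f g : j ⟶ truncatedMk 0 (by decide)) : f = g :=
  ObjectProperty.hom_ext _ (Subsingleton.elim (α := j.obj ⟶ ⦋0⦌) _ _)

/-- `[0]` is terminal in `Δ₂`. -/
def isTerminalTruncatedZero : IsTerminal (truncatedMk 0 (by decide)) :=
  IsTerminal.ofUniqueHom (fun j => ObjectProperty.homMk (SimplexCategory.const j.obj ⦋0⦌ 0))
    (fun _ _ => truncated_hom_ext_zero _ _)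

/-- Any two points of an object of `Δ₂` are joined by an edge, in one of the two directions. -/
theorem exists_edge {j : SimplexCategory.Truncated 2} (f g : truncatedMk 0 (by decide) ⟶ j) :
    ∃ h : truncatedMk 1 (by decide) ⟶ j,
      (simplexPoint _ 0 ≫ h = f ∧ simplexPoint _ 1 ≫ h = g) ∨
        (simplexPoint _ 0 ≫ h = g ∧ simplexPoint _ 1 ≫ h = f) := by
  obtain ⟨a, rfl⟩ := simplexPoint_surjective f
  obtain ⟨b, rfl⟩ := simplexPoint_surjective g
  rcases le_total a b with hab | hab
  · exact ⟨ObjectProperty.homMk (mkOfLe (n := j.obj.len) a b hab),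
      Or.inl ⟨simplexPoint_comp _ _, simplexPoint_comp _ _⟩⟩
  · exact ⟨ObjectProperty.homMk (mkOfLe (n := j.obj.len) b a hab),
      Or.inr ⟨simplexPoint_comp _ _, simplexPoint_comp _ _⟩⟩

/-- The unique object of the value at `[0]` of the weight for reflexive codescent objects. -/
noncomputable def reflexiveCodescentPoint :
    reflexiveCodescentWeight.{u}.obj (truncatedMk 0 (by decide)) :=
  FreeGroupoid.mk (C := ULift.{u} (Fin 1)) ⟨0⟩

/-- The free groupoid on `[n]` has the objects of `[n]`, which are its points; it is indiscrete
because `0` is initial in `[n]`. -/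
theorem isIndiscretelyRepresentedBy_reflexiveCodescentPoint :
    IsIndiscretelyRepresentedBy reflexiveCodescentWeight.{u} reflexiveCodescentPoint.{u} where
  bijective j := by
    refine ⟨fun f g h => ?_, fun x => ?_⟩
    · obtain ⟨a, rfl⟩ := simplexPoint_surjective f
      obtain ⟨b, rfl⟩ := simplexPoint_surjective g
      have h' : (⟨a⟩ : ULift.{u} (Fin (j.obj.len + 1))) = ⟨b⟩ :=
        FreeGroupoid.of_obj_bijective.1 h
      rw [ULift.up_injective h']
    · obtain ⟨⟨i⟩, rfl⟩ := (FreeGroupoid.of_obj_bijective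
        (C := ULift.{u} (Fin (j.obj.len + 1)))).2 x
      exact ⟨simplexPoint j i, rfl⟩
  unique_hom j x y :=
    FreeGroupoid.nonempty_unique_hom (C := ULift.{u} (Fin (j.obj.len + 1)))
      (a := ⟨0⟩) (IsInitial.ofUniqueHom (fun x => homOfLE (Fin.zero_le x.down))
        (fun _ _ => Subsingleton.elim _ _)) x y

end Simplices

end WeightedColimits

/-! ### The pseudomorphism classifier of a thin weight, and flexibility -/

namespace WeightedColimits

section Classifier

variable {J : Type} [Category.{0} J]

namespace Pseudonatural

variable {W X : J ⥤ Cat.{u, u}}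

theorem ext_of_eqToHom {α β : Pseudonatural W X}
    (hobj : ∀ (j : J) (x : W.obj j), (α.app j).obj x = (β.app j).obj x)
    (hmap : ∀ (j : J) (x y : W.obj j) (m : x ⟶ y),
      (α.app j).map m = eqToHom (hobj j x) ≫ (β.app j).map m ≫ eqToHom (hobj j y).symm)
    (hcoh : ∀ {j k : J} (f : j ⟶ k) (x : W.obj j),
      (α.coh f).hom.app x = eqToHom (hobj k _) ≫ (β.coh f).hom.app x ≫
        eqToHom (congrArg (X.map f).toFunctor.obj (hobj j x).symm)) :
    α = β := by
  obtain ⟨a, c, _, _⟩ := α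
  obtain ⟨b, d, _, _⟩ := β
  obtain rfl : a = b := funext fun j => CategoryTheory.Functor.ext (hobj j) (hmap j)
  obtain rfl : @c = @d := by
    funext j k f
    ext x
    simpa using hcoh f x
  rfl

theorem coh_congr (α : Pseudonatural W X) {j k : J} {f g : j ⟶ k} (h : f = g) (x : W.obj j) :
    (α.coh f).hom.app x = eqToHom (by rw [h]) ≫ (α.coh g).hom.app x ≫ eqToHom (by rw [h]) := by
  subst h
  simp

theorem coh_id_inv (α : Pseudonatural W X) (j : J) (x : W.obj j) :
    (α.coh (𝟙 j)).inv.app x = eqToHom (by simp) := by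
  rw [← cancel_epi ((α.coh (𝟙 j)).hom.app x), Iso.hom_inv_id_app, α.coh_id]
  simp

theorem coh_comp_inv (α : Pseudonatural W X) {i j k : J} (f : i ⟶ j) (g : j ⟶ k)
    (x : W.obj i) :
    (α.coh (f ≫ g)).inv.app x =
      eqToHom (by simp) ≫ (X.map g).toFunctor.map ((α.coh f).inv.app x) ≫
        (α.coh g).inv.app ((W.map f).toFunctor.obj x) ≫ eqToHom (by simp) := by
  rw [← cancel_epi ((α.coh (f ≫ g)).hom.app x), Iso.hom_inv_id_app, α.coh_comp]
  have h : (X.map g).toFunctor.map ((α.coh f).hom.app x) ≫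
      (X.map g).toFunctor.map ((α.coh f).inv.app x) = 𝟙 _ := by
    rw [← Functor.map_comp, Iso.hom_inv_id_app, CategoryTheory.Functor.map_id]
  have h' := Iso.hom_inv_id_app (α.coh g) ((W.map f).toFunctor.obj x)
  simp [reassoc_of% h, reassoc_of% h']

end Pseudonatural

/-- The objects of the value at `j` of the pseudomorphism classifier of `W`. -/
structure ClassifierObj (W : J ⥤ Cat.{u, u}) (j : J) : Type u where
  /-- The object of `J` on which the generator lives. -/
  src : J
  /-- The arrow along which it is pushed forward. -/
  hom : src ⟶ j
  /-- The generator. -/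
  pt : W.obj src

/-- The object of `W j` underlying an object of the pseudomorphism classifier. -/
abbrev ClassifierObj.val {W : J ⥤ Cat.{u, u}} {j : J} (a : ClassifierObj W j) : W.obj j :=
  (W.map a.hom).toFunctor.obj a.pt

variable (W : J ⥤ Cat.{u, u})

/-- The value at `j` of the pseudomorphism classifier of `W`: a category equivalent to `W j` whose
objects are freely generated. -/
abbrev ClassifierCat (j : J) : Type u :=
  InducedCategory (W.obj j) (ClassifierObj.val (W := W) (j := j))

instance [∀ j, Quiver.IsThin (W.obj j)] (j : J) : Quiver.IsThin (ClassifierCat W j) :=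
  fun _ _ => ⟨fun _ _ => InducedCategory.hom_ext (Subsingleton.elim _ _)⟩

variable [∀ j, Quiver.IsThin (W.obj j)]

-- Since the classifier inherits thinness from `W`, this settles all equations between its
-- morphisms, including the coherence laws of the unit.
variable {W} in
theorem ClassifierCat.hom_eq {j : J} {a b : ClassifierCat W j} (m n : a ⟶ b) : m = n :=
  Subsingleton.elim _ _

/-- The pseudomorphism classifier of a weight with thin values. -/
def classifier : J ⥤ Cat.{u, u} where
  obj j := Cat.of (ClassifierCat W j)
  map {j k} h := Functor.toCatHom
    { obj := fun a => (⟨a.src, a.hom ≫ h, a.pt⟩ : ClassifierObj W k)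
      map := fun {a b} m => InducedCategory.homMk
        (eqToHom (by simp [ClassifierObj.val]) ≫ (W.map h).toFunctor.map m.hom ≫
          eqToHom (by simp [ClassifierObj.val]))
      map_id := fun _ => ClassifierCat.hom_eq _ _
      map_comp := fun _ _ => ClassifierCat.hom_eq _ _ }
  map_id j := by
    refine Cat.ext (CategoryTheory.Functor.ext (fun a => ?_)
      (fun _ _ _ => ClassifierCat.hom_eq _ _))
    change (⟨a.src, a.hom ≫ 𝟙 j, a.pt⟩ : ClassifierObj W j) = a
    rw [Category.comp_id]
    rfl
  map_comp {i j k} f g := by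
    refine Cat.ext (CategoryTheory.Functor.ext (fun a => ?_)
      (fun _ _ _ => ClassifierCat.hom_eq _ _))
    change (⟨a.src, a.hom ≫ f ≫ g, a.pt⟩ : ClassifierObj W k) = ⟨a.src, (a.hom ≫ f) ≫ g, a.pt⟩
    rw [Category.assoc]

/-- The isomorphism in the pseudomorphism classifier between two objects with isomorphic
underlying objects. -/
def classifierIso {j : J} (a b : ClassifierObj W j) (e : a.val = b.val) :
    @Iso ((classifier W).obj j) _ a b where
  hom := InducedCategory.homMk (eqToHom e)
  inv := InducedCategory.homMk (eqToHom e.symm)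
  hom_inv_id := ClassifierCat.hom_eq _ _
  inv_hom_id := ClassifierCat.hom_eq _ _

/-- The unit of the pseudomorphism classifier. -/
def classifierUnit : Pseudonatural W (classifier W) where
  app j :=
    { obj := fun x => (⟨j, 𝟙 j, x⟩ : ClassifierObj W j)
      map := fun m => InducedCategory.homMk
        (eqToHom (by simp [ClassifierObj.val]) ≫ m ≫ eqToHom (by simp [ClassifierObj.val]))
      map_id := fun _ => ClassifierCat.hom_eq _ _
      map_comp := fun _ _ => ClassifierCat.hom_eq _ _ }
  coh {j k} f := NatIso.ofComponents
    (fun x => classifierIso W ⟨k, 𝟙 k, (W.map f).toFunctor.obj x⟩ ⟨j, 𝟙 j ≫ f, x⟩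
      (by simp [ClassifierObj.val]))
    (fun _ => ClassifierCat.hom_eq _ _)
  coh_id _ _ := ClassifierCat.hom_eq _ _
  coh_comp _ _ _ := ClassifierCat.hom_eq _ _

/-- The counit of the pseudomorphism classifier. -/
def classifierCounit : classifier W ⟶ W where
  app j := Functor.toCatHom (C := ClassifierCat W j) (inducedFunctor _)
  naturality j k f :=
    Cat.ext (CategoryTheory.Functor.ext (fun (a : ClassifierObj W j) => by
        change (W.map (a.hom ≫ f)).toFunctor.obj a.pt = 
          (W.map f).toFunctor.obj ((W.map a.hom).toFunctor.obj a.pt)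
        simp)
      (fun _ _ _ => Subsingleton.elim _ _))

theorem classifierUnit_comp_counit :
    (classifierUnit W).comp (toPseudonatural (classifierCounit W)) = Pseudonatural.id W := by
  refine Pseudonatural.ext_of_eqToHom (fun j x => ?_) (fun _ _ _ _ => Subsingleton.elim _ _)
    (fun _ _ => Subsingleton.elim _ _)
  change (W.map (𝟙 j)).toFunctor.obj x = x
  simp

variable {W}

/-- The section sends an object to the generator `x₀` pushed along the arrow that represents the
object. Applying `W f` composes the representing arrow with `f`, which is exactly how `classifier W`
acts, so the section is strictly natural. -/
theorem exists_section_classifierCounit {j₀ : J} {x₀ : W.obj j₀}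
    (h : ∀ j, Function.Bijective fun f : j₀ ⟶ j => (W.map f).toFunctor.obj x₀) :
    ∃ s : W ⟶ classifier W, s ≫ classifierCounit W = 𝟙 W := by
  choose pt hpt using fun (j : J) (x : W.obj j) => (h j).2 x
  have hpt' (j : J) (f : j₀ ⟶ j) : pt j ((W.map f).toFunctor.obj x₀) = f := (h j).1 (hpt _ _)
  refine ⟨
    { app := fun j => Functor.toCatHom (D := ClassifierCat W j)
        { obj := fun x => (⟨j₀, pt j x, x₀⟩ : ClassifierObj W j)
          map := fun {x y} m => InducedCategory.homMk
            (eqToHom (hpt j x) ≫ m ≫ eqToHom (hpt j y).symm)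
          map_id := fun _ => ClassifierCat.hom_eq _ _
          map_comp := fun _ _ => ClassifierCat.hom_eq _ _ }
      naturality := fun j k f => Cat.ext (CategoryTheory.Functor.ext (fun x => ?_)
        (fun _ _ _ => ClassifierCat.hom_eq _ _)) }, ?_⟩
  · change (⟨j₀, pt k ((W.map f).toFunctor.obj x), x₀⟩ : ClassifierObj W k) =
      ⟨j₀, pt j x ≫ f, x₀⟩
    obtain ⟨g, rfl⟩ := (h j).2 x
    have e : (W.map f).toFunctor.obj ((W.map g).toFunctor.obj x₀) =
      (W.map (g ≫ f)).toFunctor.obj x₀ := by simp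
    rw [hpt', e, hpt']
  · ext j : 2
    exact Cat.ext (CategoryTheory.Functor.ext (fun x => hpt j x) (fun _ _ _ => Subsingleton.elim _ _))

/-- The 2-natural transformation out of the pseudomorphism classifier that corresponds to a
pseudonatural transformation. -/
def classifierDesc {X : J ⥤ Cat.{u, u}} (α : Pseudonatural W X) : classifier W ⟶ X where
  app j := Functor.toCatHom (C := ClassifierCat W j)
    { obj := fun a => (X.map a.hom).toFunctor.obj ((α.app a.src).obj a.pt)
      map := fun {a b} m =>
        (α.coh a.hom).inv.app a.pt ≫ (α.app j).map m.hom ≫ (α.coh b.hom).hom.app b.pt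
      map_id := fun a => by
        simp
      map_comp := fun {a b c} m n => by
        simp }
  naturality j k h := by
    refine Cat.ext (CategoryTheory.Functor.ext (fun a => ?_) (fun a b m => ?_))
    · change (X.map (a.hom ≫ h)).toFunctor.obj ((α.app a.src).obj a.pt) =
        (X.map h).toFunctor.obj ((X.map a.hom).toFunctor.obj ((α.app a.src).obj a.pt))
      simp
    · change (α.coh (a.hom ≫ h)).inv.app a.pt ≫ (α.app k).map (eqToHom _ ≫
          (W.map h).toFunctor.map m.hom ≫ eqToHom _) ≫ (α.coh (b.hom ≫ h)).hom.app b.pt =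
        eqToHom _ ≫ (X.map h).toFunctor.map
          ((α.coh a.hom).inv.app a.pt ≫ (α.app j).map m.hom ≫ (α.coh b.hom).hom.app b.pt) ≫
            eqToHom _
      -- The coherence cells at `a.hom ≫ h` and `b.hom ≫ h` both split off a cell at `h`; naturality
      -- of that cell at `m` cancels the two.
      have hn := (α.coh h).hom.naturality m.hom
      simp only [Functor.comp_map] at hn
      rw [α.coh_comp, α.coh_comp_inv]
      simp [eqToHom_map]
      rw [reassoc_of% hn]
      simp

theorem classifierUnit_comp_coh {X : J ⥤ Cat.{u, u}} (β : classifier W ⟶ X) {j k : J}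
    (f : j ⟶ k) (x : W.obj j) :
    (((classifierUnit W).comp (toPseudonatural β)).coh f).hom.app x =
      (β.app k).toFunctor.map (((classifierUnit W).coh f).hom.app x) ≫
        eqToHom (congrArg (fun F => F.toFunctor.obj (((classifierUnit W).app j).obj x))
          (β.naturality f)) := by
  simp [Pseudonatural.comp, toPseudonatural, eqToHom_app]

theorem classifierUnit_comp_coh_inv {X : J ⥤ Cat.{u, u}} (β : classifier W ⟶ X) {j k : J}
    (f : j ⟶ k) (x : W.obj j) :
    (((classifierUnit W).comp (toPseudonatural β)).coh f).inv.app x =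
      eqToHom (congrArg (fun F => F.toFunctor.obj (((classifierUnit W).app j).obj x))
          (β.naturality f).symm) ≫
        (β.app k).toFunctor.map (((classifierUnit W).coh f).inv.app x) := by
  simp [Pseudonatural.comp, toPseudonatural, eqToHom_app]

theorem map_comp_eqToHom_conj {C D : Type u} [Category.{u} C] [Category.{u} D] (F : C ⥤ D)
    {a a₀ x y b b₀ : C} (ha : a = a₀) (hb : b = b₀) {i : a ⟶ x} {p : x ⟶ y} {c : y ⟶ b}
    {m : a₀ ⟶ b₀} (h : i ≫ p ≫ c = eqToHom ha ≫ m ≫ eqToHom hb.symm) {d d' : D}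
    (h₁ : d = F.obj a) (h₂ : F.obj b = d') (h₃ : d = F.obj a₀) (h₄ : F.obj b₀ = d') :
    (eqToHom h₁ ≫ F.map i) ≫ F.map p ≫ F.map c ≫ eqToHom h₂ =
      eqToHom h₃ ≫ F.map m ≫ eqToHom h₄ := by
  subst ha hb h₁ h₂
  have h' : F.map i ≫ F.map p ≫ F.map c = F.map m := by
    rw [← F.map_comp, ← F.map_comp, h]
    simp
  simpa using h'

/-- Every object of the classifier is the strict pushforward of a unit object, so naturality of `β`
fixes its value there. Every morphism is the image of a morphism of `W j` under the unit, conjugated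
by coherence cells. -/
theorem classifierDesc_comp {X : J ⥤ Cat.{u, u}} (β : classifier W ⟶ X) :
    classifierDesc ((classifierUnit W).comp (toPseudonatural β)) = β := by
  ext j : 2
  have hobj (a : ClassifierObj W j) :
      ((classifierDesc ((classifierUnit W).comp (toPseudonatural β))).app j).toFunctor.obj a =
        (β.app j).toFunctor.obj a := by
    have h := congrArg (fun F => F.toFunctor.obj (((classifierUnit W).app a.src).obj a.pt))
      (β.naturality a.hom)
    refine h.symm.trans ?_
    change (β.app j).toFunctor.obj (⟨a.src, 𝟙 _ ≫ a.hom, a.pt⟩ : ClassifierObj W j) = _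
    rw [Category.id_comp]
  refine Cat.ext (CategoryTheory.Functor.ext hobj (fun a b m => ?_))
  change (((classifierUnit W).comp (toPseudonatural β)).coh a.hom).inv.app a.pt ≫
    (β.app j).toFunctor.map (((classifierUnit W).app j).map m.hom) ≫
      (((classifierUnit W).comp (toPseudonatural β)).coh b.hom).hom.app b.pt = _
  rw [classifierUnit_comp_coh, classifierUnit_comp_coh_inv]
  have e (a : ClassifierObj W j) :
      ((classifier W).map a.hom).toFunctor.obj (((classifierUnit W).app a.src).obj a.pt) = a := by
    change (⟨a.src, 𝟙 _ ≫ a.hom, a.pt⟩ : ClassifierObj W j) = _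
    rw [Category.id_comp]
  have hm : ((classifierUnit W).coh a.hom).inv.app a.pt ≫
      ((classifierUnit W).app j).map m.hom ≫ ((classifierUnit W).coh b.hom).hom.app b.pt =
      eqToHom (e a) ≫ m ≫ eqToHom (e b).symm := ClassifierCat.hom_eq _ _
  exact map_comp_eqToHom_conj (β.app j).toFunctor (e a) (e b) hm _ _ _ _

theorem classifierUnit_comp_desc {X : J ⥤ Cat.{u, u}} (α : Pseudonatural W X) :
    (classifierUnit W).comp (toPseudonatural (classifierDesc α)) = α := by
  refine Pseudonatural.ext_of_eqToHom (fun j x => ?_) (fun j x y m => ?_) (fun {j k} f x => ?_)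
  · change (X.map (𝟙 j)).toFunctor.obj ((α.app j).obj x) = _
    simp
  · change (α.coh (𝟙 j)).inv.app x ≫ (α.app j).map (eqToHom _ ≫ m ≫ eqToHom _) ≫
      (α.coh (𝟙 j)).hom.app y = _
    rw [α.coh_id, α.coh_id_inv]
    simp [eqToHom_map]
    rfl
  · rw [classifierUnit_comp_coh]
    change ((α.coh (𝟙 k)).inv.app ((W.map f).toFunctor.obj x) ≫ (α.app k).map (eqToHom (by simp)) ≫
      (α.coh (𝟙 j ≫ f)).hom.app x) ≫ eqToHom _ = _
    rw [α.coh_id_inv, α.coh_congr (Category.id_comp f)]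
    simp [eqToHom_map]
    exact congrArg (_ ≫ _ ≫ ·) (eqToHom_trans _ _)

/-- Every object of the pseudomorphism classifier is isomorphic to one in the image of the
unit. -/
def classifierUnitObjIso {j : J} (a : ClassifierObj W j) :
    @Iso ((classifier W).obj j) _ (((classifierUnit W).app j).obj a.val) a :=
  classifierIso W ⟨j, 𝟙 j, a.val⟩ a (by simp [ClassifierObj.val])

theorem exists_classifierUnit_map {j : J} {x y : W.obj j}
    (m : @Quiver.Hom (ClassifierCat W j) _ ⟨j, 𝟙 j, x⟩ ⟨j, 𝟙 j, y⟩) :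
    ∃ t, m = ((classifierUnit W).app j).map t :=
  ⟨eqToHom (by simp : x = (W.map (𝟙 j)).toFunctor.obj x) ≫ m.hom ≫
    eqToHom (by simp : (W.map (𝟙 j)).toFunctor.obj y = y),
    ClassifierCat.hom_eq _ _⟩

/-! ### Extending modifications along the unit of the classifier -/

section Modification

variable {X : J ⥤ Cat.{u, u}} {β γ : classifier W ⟶ X}
  (μ : (classifierUnit W).comp (toPseudonatural β) ⟶
    (classifierUnit W).comp (toPseudonatural γ))

/-- The component of a modification at an object in the image of the unit. -/
def unitModificationApp {j : J} (x : W.obj j) :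
    (β.app j).toFunctor.obj (((classifierUnit W).app j).obj x) ⟶
      (γ.app j).toFunctor.obj (((classifierUnit W).app j).obj x) :=
  (Modification.app μ j).app x

theorem unitModificationApp_naturality {j : J} {x y : W.obj j}
    (m : ((classifierUnit W).app j).obj x ⟶ ((classifierUnit W).app j).obj y) :
    (β.app j).toFunctor.map m ≫ unitModificationApp μ y =
      unitModificationApp μ x ≫ (γ.app j).toFunctor.map m := by
  obtain ⟨t, rfl⟩ := exists_classifierUnit_map (W := W) m
  exact (Modification.app μ j).naturality t

theorem unitModificationApp_coh {j k : J} (f : j ⟶ k) (x : W.obj j) :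
    unitModificationApp μ ((W.map f).toFunctor.obj x) ≫
        (γ.app k).toFunctor.map (((classifierUnit W).coh f).hom.app x) ≫
        eqToHom (congrArg (fun F => F.toFunctor.obj (((classifierUnit W).app j).obj x))
          (γ.naturality f)) =
      (β.app k).toFunctor.map (((classifierUnit W).coh f).hom.app x) ≫
        eqToHom (congrArg (fun F => F.toFunctor.obj (((classifierUnit W).app j).obj x))
          (β.naturality f)) ≫ (X.map f).toFunctor.map (unitModificationApp μ x) := by
  have h := Modification.naturality μ f x
  rw [classifierUnit_comp_coh, classifierUnit_comp_coh] at h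
  exact h.trans (Category.assoc _ _ _)

/-- The component of the modification induced by the universal property of the pseudomorphism
classifier. -/
def descModificationApp {j : J} (a : (classifier W).obj j) :
    (β.app j).toFunctor.obj a ⟶ (γ.app j).toFunctor.obj a :=
  (β.app j).toFunctor.map (classifierUnitObjIso a).inv ≫ unitModificationApp μ _ ≫
    (γ.app j).toFunctor.map (classifierUnitObjIso a).hom

/-- Independence of the isomorphism used to transport the component from the image of the unit.
Compatibility with the arrows of `J` needs an isomorphism other than the one in the definition. -/
theorem descModificationApp_eq {j : J} (a : (classifier W).obj j) {z : W.obj j}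
    (e : ((classifierUnit W).app j).obj z ≅ a) :
    descModificationApp μ a = (β.app j).toFunctor.map e.inv ≫ unitModificationApp μ z ≫
      (γ.app j).toFunctor.map e.hom := by
  have h := unitModificationApp_naturality μ (e.hom ≫ (classifierUnitObjIso a).inv)
  have h' : (γ.app j).toFunctor.map e.hom = (γ.app j).toFunctor.map
      (e.hom ≫ (classifierUnitObjIso a).inv) ≫
        (γ.app j).toFunctor.map (classifierUnitObjIso a).hom := by
    rw [← Functor.map_comp, Category.assoc, Iso.inv_hom_id, Category.comp_id]
  rw [h', ← reassoc_of% h, ← Functor.map_comp_assoc, Iso.inv_hom_id_assoc]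
  rfl

theorem descModificationApp_unit {j : J} (x : W.obj j) :
    descModificationApp μ (((classifierUnit W).app j).obj x) = unitModificationApp μ x := by
  rw [descModificationApp_eq μ _ (Iso.refl _)]
  simp

theorem descModificationApp_naturality {j : J} {a b : (classifier W).obj j} (m : a ⟶ b) :
    (β.app j).toFunctor.map m ≫ descModificationApp μ b =
      descModificationApp μ a ≫ (γ.app j).toFunctor.map m := by
  have h := unitModificationApp_naturality μ
    ((classifierUnitObjIso a).hom ≫ m ≫ (classifierUnitObjIso b).inv)
  have hb : m ≫ (classifierUnitObjIso b).inv = (classifierUnitObjIso a).inv ≫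
    (classifierUnitObjIso a).hom ≫ m ≫ (classifierUnitObjIso b).inv := by simp
  have ha : (classifierUnitObjIso a).hom ≫ m = ((classifierUnitObjIso a).hom ≫ m ≫
    (classifierUnitObjIso b).inv) ≫ (classifierUnitObjIso b).hom := by simp
  unfold descModificationApp
  rw [← Functor.map_comp_assoc, hb, Functor.map_comp_assoc, reassoc_of% h, Category.assoc,
    Category.assoc, ← Functor.map_comp, ← Functor.map_comp, ← ha]

theorem map_app_eqToHom {Q : J ⥤ Cat.{u, u}} (δ : Q ⟶ X) {j k : J} (f : j ⟶ k)
    {a b : Q.obj j} (n : a ⟶ b) :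
    (δ.app k).toFunctor.map ((Q.map f).toFunctor.map n) ≫
        eqToHom (congrArg (fun F => F.toFunctor.obj b) (δ.naturality f)) =
      eqToHom (congrArg (fun F => F.toFunctor.obj a) (δ.naturality f)) ≫
        (X.map f).toFunctor.map ((δ.app j).toFunctor.map n) := by
  have h := Functor.congr_hom (congrArg Cat.Hom.toFunctor (δ.naturality f)) n
  refine (congrArg (· ≫ _) h).trans ?_
  simp

theorem descModificationApp_map {j k : J} (f : j ⟶ k) (a : (classifier W).obj j) :
    descModificationApp μ (((classifier W).map f).toFunctor.obj a) ≫
        eqToHom (congrArg (fun F => F.toFunctor.obj a) (γ.naturality f)) =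
      eqToHom (congrArg (fun F => F.toFunctor.obj a) (β.naturality f)) ≫
        (X.map f).toFunctor.map (descModificationApp μ a) := by
  have h := unitModificationApp_coh μ f (ClassifierObj.val a)
  have hi : (β.app k).toFunctor.map
      (((classifierUnit W).coh f).inv.app (ClassifierObj.val a)) ≫ (β.app k).toFunctor.map
        (((classifierUnit W).coh f).hom.app (ClassifierObj.val a)) = 𝟙 _ := by
    rw [← Functor.map_comp, Iso.inv_hom_id_app, CategoryTheory.Functor.map_id]
  have hβ := map_app_eqToHom β f (classifierUnitObjIso a).inv
  have hγ := map_app_eqToHom γ f (classifierUnitObjIso a).hom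
  -- Of the isomorphisms onto the pushforward of `a`, this one goes through the coherence cell at
  -- `f`, so that the modification axiom for `μ` applies.
  rw [descModificationApp_eq μ _ (((classifierUnit W).coh f).app (ClassifierObj.val a) ≪≫
    ((classifier W).map f).toFunctor.mapIso (classifierUnitObjIso a))]
  simp only [Iso.trans_inv, Iso.trans_hom, Functor.mapIso_inv, Functor.mapIso_hom, Iso.app_hom,
    Iso.app_inv, Functor.map_comp, Category.assoc, hγ]
  rw [reassoc_of% h, reassoc_of% hi, reassoc_of% hβ]
  simp only [descModificationApp, Functor.map_comp]

end Modification

theorem isPseudomorphismClassifier_classifierUnit :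
    IsPseudomorphismClassifier (classifierUnit W) := fun X => by
  refine ⟨⟨fun {β γ} μ => ?_⟩, ⟨fun {β γ} m n h => ?_⟩,
    fun β γ h => ?_, fun α => ⟨classifierDesc α, classifierUnit_comp_desc α⟩⟩
  · refine ⟨InducedCategory.homMk
      { app := fun j =>
          { app := fun a => descModificationApp μ a
            naturality := fun _ _ m => descModificationApp_naturality μ m }
        naturality := fun {j k} f a => ?_ }, ?_⟩
    · simp only [toPseudonatural, eqToIso.hom, eqToHom_app]
      exact descModificationApp_map μ f a
    · refine Modification.ext (funext fun j => NatTrans.ext (funext fun x => ?_))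
      exact descModificationApp_unit μ x
  · refine InducedCategory.hom_ext (Modification.ext (funext fun j =>
      NatTrans.ext (funext fun a => ?_)))
    -- Every object is isomorphic to one in the image of the unit, where `m` and `n` agree;
    -- naturality along the isomorphism transfers the equality.
    have hm := (m.hom.app j).naturality (classifierUnitObjIso a).hom
    have hn := (n.hom.app j).naturality (classifierUnitObjIso a).hom
    have e : (m.hom.app j).app (((classifierUnit W).app j).obj (ClassifierObj.val a)) =
        (n.hom.app j).app (((classifierUnit W).app j).obj (ClassifierObj.val a)) :=
      congrArg (fun μ => (Modification.app μ j).app (ClassifierObj.val a)) h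
    rw [e, ← hn] at hm
    exact (cancel_epi _).1 hm
  · rw [← classifierDesc_comp β, ← classifierDesc_comp γ]
    exact congrArg classifierDesc h

theorem isFlexible_of_bijective {j₀ : J} {x₀ : W.obj j₀}
    (h : ∀ j, Function.Bijective fun f : j₀ ⟶ j => (W.map f).toFunctor.obj x₀) :
    IsFlexible W :=
  ⟨classifier W, classifierUnit W, classifierCounit W, isPseudomorphismClassifier_classifierUnit,
    classifierUnit_comp_counit W, exists_section_classifierCounit h⟩

end Classifier

end WeightedColimits

/-! ### Codescent data and the codescent category -/

namespace WeightedColimits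

section Codescent

variable {J : Type} [Category.{0} J]

/-- The action of an arrow of `J` on the values of a diagram. -/
abbrev act (D : Jᵒᵖ ⥤ Cat.{u, u}) {i j : J} (f : i ⟶ j) : D.obj (op j) ⥤ D.obj (op i) :=
  (D.map f.op).toFunctor

theorem act_id (D : Jᵒᵖ ⥤ Cat.{u, u}) (j : J) : act D (𝟙 j) = 𝟭 _ :=
  congrArg Cat.Hom.toFunctor (D.map_id (op j))

theorem act_comp (D : Jᵒᵖ ⥤ Cat.{u, u}) {i j k : J} (f : i ⟶ j) (g : j ⟶ k) :
    act D (f ≫ g) = act D g ⋙ act D f :=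
  congrArg Cat.Hom.toFunctor (D.map_comp g.op f.op)

theorem act_id_obj (D : Jᵒᵖ ⥤ Cat.{u, u}) {j : J} (z : D.obj (op j)) :
    (act D (𝟙 j)).obj z = z :=
  Functor.congr_obj (act_id D j) z

theorem act_comp_obj (D : Jᵒᵖ ⥤ Cat.{u, u}) {i j k : J} (f : i ⟶ j) (g : j ⟶ k)
    (z : D.obj (op k)) : (act D (f ≫ g)).obj z = (act D f).obj ((act D g).obj z) :=
  Functor.congr_obj (act_comp D f g) z

theorem act_naturality {D E : Jᵒᵖ ⥤ Cat.{u, u}} (φ : D ⟶ E) {i j : J} (f : i ⟶ j) :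
    act D f ⋙ (φ.app (op i)).toFunctor = (φ.app (op j)).toFunctor ⋙ act E f :=
  congrArg Cat.Hom.toFunctor (φ.naturality f.op)

theorem act_naturality_obj {D E : Jᵒᵖ ⥤ Cat.{u, u}} (φ : D ⟶ E) {i j : J} (f : i ⟶ j)
    (z : D.obj (op j)) : (act E f).obj ((φ.app (op j)).toFunctor.obj z) =
      (φ.app (op i)).toFunctor.obj ((act D f).obj z) :=
  (Functor.congr_obj (act_naturality φ f) z).symm

/-- Codescent data in `A` for a diagram `D`, relative to an object `j₀` of `J`: a functor from
`D j₀` to `A` together with a coherent system of 2-cells between its composites with the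
functors `D f`, for `f : j₀ ⟶ j`. -/
structure CodescentData (D : Jᵒᵖ ⥤ Cat.{u, u}) (j₀ : J) (A : Type*) [Category A] where
  /-- The underlying functor. -/
  functor : D.obj (op j₀) ⥤ A
  /-- The 2-cells. -/
  cell {j : J} (f g : j₀ ⟶ j) (z : D.obj (op j)) {c c' : D.obj (op j₀)}
    (hf : (act D f).obj z = c) (hg : (act D g).obj z = c') : functor.obj c ⟶ functor.obj c'
  cell_self {j : J} (f : j₀ ⟶ j) (z : D.obj (op j)) : cell f f z rfl rfl = 𝟙 _
  cell_comp {j : J} (f g h : j₀ ⟶ j) (z : D.obj (op j)) :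
    cell f g z rfl rfl ≫ cell g h z rfl rfl = cell f h z rfl rfl
  cell_naturality {j : J} (f g : j₀ ⟶ j) {z z' : D.obj (op j)} (m : z ⟶ z') :
    functor.map ((act D f).map m) ≫ cell f g z' rfl rfl =
      cell f g z rfl rfl ≫ functor.map ((act D g).map m)
  cell_map {j k : J} (f g : j₀ ⟶ j) (h : j ⟶ k) (z : D.obj (op k)) :
    cell f g ((act D h).obj z) rfl rfl =
      cell (f ≫ h) (g ≫ h) z (act_comp_obj D f h z) (act_comp_obj D g h z)

variable (D : Jᵒᵖ ⥤ Cat.{u, u}) (j₀ : J)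

/-- Words in the generating morphisms of the codescent category. -/
inductive CodescentWord : D.obj (op j₀) → D.obj (op j₀) → Type u
  | base {c c' : D.obj (op j₀)} (m : c ⟶ c') : CodescentWord c c'
  | cell {j : J} (f g : j₀ ⟶ j) (z : D.obj (op j)) {c c' : D.obj (op j₀)}
      (hf : (act D f).obj z = c) (hg : (act D g).obj z = c') : CodescentWord c c'
  | comp {c c' c'' : D.obj (op j₀)} (v : CodescentWord c c') (w : CodescentWord c' c'') :
      CodescentWord c c''

open CodescentWord in
/-- The relations between words that define the codescent category. -/
inductive CodescentRel :
    ∀ {c c' : D.obj (op j₀)}, CodescentWord D j₀ c c' → CodescentWord D j₀ c c' → Prop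
  | comp_left {c c' c''} (v : CodescentWord D j₀ c c') {w w' : CodescentWord D j₀ c' c''}
      (h : CodescentRel w w') : CodescentRel (comp v w) (comp v w')
  | comp_right {c c' c''} {v v' : CodescentWord D j₀ c c'} (w : CodescentWord D j₀ c' c'')
      (h : CodescentRel v v') : CodescentRel (comp v w) (comp v' w)
  | id_comp {c c'} (v : CodescentWord D j₀ c c') : CodescentRel (comp (base (𝟙 c)) v) v
  | comp_id {c c'} (v : CodescentWord D j₀ c c') : CodescentRel (comp v (base (𝟙 c'))) v
  | assoc {c₁ c₂ c₃ c₄} (v : CodescentWord D j₀ c₁ c₂) (w : CodescentWord D j₀ c₂ c₃)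
      (x : CodescentWord D j₀ c₃ c₄) : CodescentRel (comp (comp v w) x) (comp v (comp w x))
  | base_comp {c c' c'' : D.obj (op j₀)} (m : c ⟶ c') (n : c' ⟶ c'') :
      CodescentRel (base (m ≫ n)) (comp (base m) (base n))
  | cell_self {j : J} (f : j₀ ⟶ j) (z : D.obj (op j)) :
      CodescentRel (cell f f z rfl rfl) (base (𝟙 _))
  | cell_comp {j : J} (f g h : j₀ ⟶ j) (z : D.obj (op j)) :
      CodescentRel (comp (cell f g z rfl rfl) (cell g h z rfl rfl)) (cell f h z rfl rfl)
  | cell_naturality {j : J} (f g : j₀ ⟶ j) {z z' : D.obj (op j)} (m : z ⟶ z') :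
      CodescentRel (comp (base ((act D f).map m)) (cell f g z' rfl rfl))
        (comp (cell f g z rfl rfl) (base ((act D g).map m)))
  | cell_map {j k : J} (f g : j₀ ⟶ j) (h : j ⟶ k) (z : D.obj (op k)) :
      CodescentRel (cell f g ((act D h).obj z) rfl rfl)
        (cell (f ≫ h) (g ≫ h) z (act_comp_obj D f h z) (act_comp_obj D g h z))

/-- The objects of the codescent category of `D`. -/
@[ext]
structure CodescentCat : Type u where
  /-- The underlying object of `D j₀`. -/
  as : D.obj (op j₀)

/-- The codescent category of `D`: the category with universal codescent data for `D`. -/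
instance : Category.{u} (CodescentCat D j₀) where
  Hom c c' := Quot (CodescentRel D j₀ (c := c.as) (c' := c'.as))
  id c := Quot.mk _ (.base (𝟙 c.as))
  comp := Quot.map₂ .comp (fun v _ _ h => .comp_left v h) (fun _ _ w h => .comp_right w h)
  id_comp := by
    rintro _ _ ⟨v⟩
    exact Quot.sound (.id_comp v)
  comp_id := by
    rintro _ _ ⟨v⟩
    exact Quot.sound (.comp_id v)
  assoc := by
    rintro _ _ _ _ ⟨v⟩ ⟨w⟩ ⟨x⟩
    exact Quot.sound (.assoc v w x)

namespace CodescentCat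

/-- The universal codescent data. -/
def data : CodescentData D j₀ (CodescentCat D j₀) where
  functor :=
    { obj := fun c => ⟨c⟩
      map := fun m => Quot.mk _ (.base m)
      map_id := fun _ => rfl
      map_comp := fun m n => Quot.sound (.base_comp m n) }
  cell f g z _ _ hf hg := Quot.mk _ (.cell f g z hf hg)
  cell_self f z := Quot.sound (.cell_self f z)
  cell_comp f g h z := Quot.sound (.cell_comp f g h z)
  cell_naturality f g _ _ m := Quot.sound (.cell_naturality f g m)
  cell_map f g h z := Quot.sound (.cell_map f g h z)

variable {D j₀}

/-- To prove a property of all morphisms of the codescent category, it suffices to consider the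
generators and composites. -/
theorem induction {P : ∀ {a b : CodescentCat D j₀}, (a ⟶ b) → Prop}
    (base : ∀ {c c' : D.obj (op j₀)} (m : c ⟶ c'), P ((data D j₀).functor.map m))
    (cell : ∀ {j : J} (f g : j₀ ⟶ j) (z : D.obj (op j)), P ((data D j₀).cell f g z rfl rfl))
    (comp : ∀ {a b c : CodescentCat D j₀} (m : a ⟶ b) (n : b ⟶ c), P m → P n → P (m ≫ n))
    {a b : CodescentCat D j₀} (m : a ⟶ b) : P m := by
  have key {c c' : D.obj (op j₀)} (w : CodescentWord D j₀ c c') :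
      P (a := ⟨c⟩) (b := ⟨c'⟩) (Quot.mk _ w) := by
    induction w with
    | base m => exact base m
    | cell f g z hf hg =>
      subst hf hg
      exact cell f g z
    | comp v w hv hw => exact comp _ _ hv hw
  obtain ⟨w⟩ := m
  exact key w

section Desc

variable {A : Type*} [Category A] (d : CodescentData D j₀ A)

/-- The interpretation of words in a category equipped with codescent data. -/
def eval : ∀ {c c' : D.obj (op j₀)}, CodescentWord D j₀ c c' →
    (d.functor.obj c ⟶ d.functor.obj c')
  | _, _, .base m => d.functor.map m
  | _, _, .cell f g z hf hg => d.cell f g z hf hg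
  | _, _, .comp v w => eval v ≫ eval w

theorem eval_eq {c c' : D.obj (op j₀)} {v w : CodescentWord D j₀ c c'}
    (h : CodescentRel D j₀ v w) : eval d v = eval d w := by
  induction h with
  | comp_left v h ih => exact congrArg (_ ≫ ·) ih
  | comp_right w h ih => exact congrArg (· ≫ _) ih
  | id_comp v => simp [eval]
  | comp_id v => simp [eval]
  | assoc v w x => exact Category.assoc _ _ _
  | base_comp m n => exact d.functor.map_comp m n
  | cell_self f z => exact (d.cell_self f z).trans (d.functor.map_id _).symm
  | cell_comp f g h z => exact d.cell_comp f g h z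
  | cell_naturality f g m => exact d.cell_naturality f g m
  | cell_map f g h z => exact d.cell_map f g h z

/-- The functor out of the codescent category induced by codescent data. -/
def desc : CodescentCat D j₀ ⥤ A where
  obj c := d.functor.obj c.as
  map := Quot.lift (eval d) (fun _ _ => eval_eq d)
  map_id _ := d.functor.map_id _
  map_comp := by
    rintro _ _ _ ⟨v⟩ ⟨w⟩
    rfl

theorem hom_ext {G H : CodescentCat D j₀ ⥤ A}
    (hobj : ∀ c, G.obj c = H.obj c)
    (hbase : ∀ {c c' : D.obj (op j₀)} (m : c ⟶ c'), G.map ((data D j₀).functor.map m) =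
      eqToHom (hobj _) ≫ H.map ((data D j₀).functor.map m) ≫ eqToHom (hobj _).symm)
    (hcell : ∀ {j : J} (f g : j₀ ⟶ j) (z : D.obj (op j)),
      G.map ((data D j₀).cell f g z rfl rfl) = eqToHom (hobj _) ≫
        H.map ((data D j₀).cell f g z rfl rfl) ≫ eqToHom (hobj _).symm) : G = H := by
  refine CategoryTheory.Functor.ext hobj (fun a b m => ?_)
  induction m using induction with
  | base m => exact hbase m
  | cell f g z => exact hcell f g z
  | comp m n hm hn => simp [hm, hn]

/-- Natural transformations between functors out of the codescent category are determined by
naturality at the generators. -/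
def natTransMk {G H : CodescentCat D j₀ ⥤ A} (app : ∀ c : D.obj (op j₀), G.obj ⟨c⟩ ⟶ H.obj ⟨c⟩)
    (hbase : ∀ {c c' : D.obj (op j₀)} (m : c ⟶ c'), G.map ((data D j₀).functor.map m) ≫ app c' =
      app c ≫ H.map ((data D j₀).functor.map m))
    (hcell : ∀ {j : J} (f g : j₀ ⟶ j) (z : D.obj (op j)),
      G.map ((data D j₀).cell f g z rfl rfl) ≫ app _ =
        app _ ≫ H.map ((data D j₀).cell f g z rfl rfl)) : G ⟶ H where
  app c := app c.as
  naturality a b m := by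
    induction m using induction with
    | base m => exact hbase m
    | cell f g z => exact hcell f g z
    | comp m n hm hn => rw [Functor.map_comp, Category.assoc, hn, reassoc_of% hm, Functor.map_comp]

end Desc

end CodescentCat

namespace CodescentData

variable {D j₀} {A : Type*} [Category A] (d : CodescentData D j₀ A)

/-- The endpoints of a cell are prescribed up to an equation, so cells with equal indices may have
different types; they then differ only by `eqToHom`s. -/
theorem cell_eq_conj {j : J} {f g f' g' : j₀ ⟶ j} (ef : f = f') (eg : g = g')
    {z z' : D.obj (op j)} (ez : z = z') {c c' b b' : D.obj (op j₀)}
    (hf : (act D f).obj z = c) (hg : (act D g).obj z = c')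
    (hf' : (act D f').obj z' = b) (hg' : (act D g').obj z' = b') :
    d.cell f g z hf hg = eqToHom (by rw [← hf, ← hf', ef, ez]) ≫ d.cell f' g' z' hf' hg' ≫
      eqToHom (by rw [← hg, ← hg', eg, ez]) := by
  subst ef eg ez hf hg hf' hg'
  simp

theorem cell_self_eq {j : J} (f : j₀ ⟶ j) (z : D.obj (op j)) {c : D.obj (op j₀)}
    (hf hf' : (act D f).obj z = c) : d.cell f f z hf hf' = 𝟙 _ := by
  subst hf
  exact d.cell_self f z

theorem cell_comp_cell {j : J} (f g h : j₀ ⟶ j) (z : D.obj (op j)) {a b c : D.obj (op j₀)}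
    (hf : (act D f).obj z = a) (hg hg' : (act D g).obj z = b) (hh : (act D h).obj z = c) :
    d.cell f g z hf hg ≫ d.cell g h z hg' hh = d.cell f h z hf hh := by
  subst hf hg hh
  exact d.cell_comp f g h z

theorem map_comp_cell {j : J} (f g : j₀ ⟶ j) {z z' : D.obj (op j)} (m : z ⟶ z')
    {a b a' b' : D.obj (op j₀)}
    (hf : (act D f).obj z = a) (hg : (act D g).obj z = b)
    (hf' : (act D f).obj z' = a') (hg' : (act D g).obj z' = b') {n : a ⟶ a'} {n' : b ⟶ b'}
    (hn : (act D f).map m ≍ n) (hn' : (act D g).map m ≍ n') :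
    d.functor.map n ≫ d.cell f g z' hf' hg' = d.cell f g z hf hg ≫ d.functor.map n' := by
  subst hf hg hf' hg'
  obtain rfl := eq_of_heq hn
  obtain rfl := eq_of_heq hn'
  exact d.cell_naturality f g m

theorem cell_eq_cell {j k : J} {f g : j₀ ⟶ j} (h : j ⟶ k) {f' g' : j₀ ⟶ k} (z : D.obj (op k))
    {z' : D.obj (op j)} (hz : (act D h).obj z = z') (ef : f ≫ h = f') (eg : g ≫ h = g')
    {c c' : D.obj (op j₀)} (hf : (act D f).obj z' = c) (hg : (act D g).obj z' = c')
    (hf' : (act D f').obj z = c) (hg' : (act D g').obj z = c') :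
    d.cell f g z' hf hg = d.cell f' g' z hf' hg' := by
  subst hz ef eg hf hg
  exact d.cell_map f g h z

end CodescentData

end Codescent

end WeightedColimits

/-! ### Weighted cocones as codescent data; the codescent category as weighted colimit -/

namespace WeightedColimits

section Cocones

variable {J : Type} [Category.{0} J] {W : J ⥤ Cat.{u, u}} {j₀ : J} {x₀ : W.obj j₀}

namespace IsIndiscretelyRepresentedBy

variable (h : IsIndiscretelyRepresentedBy W x₀)

include h in
theorem isThin (j : J) : Quiver.IsThin (W.obj j) := fun x y => by
  obtain ⟨_⟩ := h.unique_hom j x y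
  infer_instance

/-- The unique morphism between two objects. -/
noncomputable def hom {j : J} (x y : W.obj j) : x ⟶ y :=
  (h.unique_hom j x y).some.default

/-- The arrow of `J` that represents an object. -/
noncomputable def point {j : J} (x : W.obj j) : j₀ ⟶ j :=
  ((h.bijective j).2 x).choose

theorem map_point_obj {j : J} (x : W.obj j) : (W.map (h.point x)).toFunctor.obj x₀ = x :=
  ((h.bijective j).2 x).choose_spec

theorem point_map_obj {j : J} (f : j₀ ⟶ j) : h.point ((W.map f).toFunctor.obj x₀) = f :=
  (h.bijective j).1 (h.map_point_obj _)

theorem point_self : h.point x₀ = 𝟙 j₀ :=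
  (h.bijective j₀).1 (by simp [h.map_point_obj])

theorem point_obj {j k : J} (f : j ⟶ k) (x : W.obj j) :
    h.point ((W.map f).toFunctor.obj x) = h.point x ≫ f :=
  (h.bijective k).1 (by simp [h.map_point_obj])

end IsIndiscretelyRepresentedBy

theorem functor_ext₂ {A B C : Type*} [Category A] [Category B] [Category C] {F G : A ⥤ (B ⥤ C)}
    (hobj : ∀ a b, (F.obj a).obj b = (G.obj a).obj b)
    (hmap : ∀ a {b b' : B} (m : b ⟶ b'), (F.obj a).map m =
      eqToHom (hobj a b) ≫ (G.obj a).map m ≫ eqToHom (hobj a b').symm)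
    (happ : ∀ {a a' : A} (n : a ⟶ a') (b : B), (F.map n).app b =
      eqToHom (hobj a b) ≫ (G.map n).app b ≫ eqToHom (hobj a' b).symm) : F = G := by
  refine CategoryTheory.Functor.ext
    (fun a => CategoryTheory.Functor.ext (hobj a) (fun _ _ m => hmap a m)) (fun a a' n => ?_)
  ext b
  simpa [eqToHom_app] using happ n b

theorem eq_eqToHom_conj {A : Type*} [Category A] {a b : A} (m : a ⟶ b) (ha : a = a)
    (hb : b = b) : m = eqToHom ha ≫ m ≫ eqToHom hb := by
  simp

theorem eqToHom_conj_square {A : Type*} [Category A] {a a' b b' c c' d d' : A} (ha : a' = a)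
    (hb : b = b') (hc : c' = c) (hd : d = d') (hb' : b = b') (hd' : d' = d) (ha' : a = a')
    (hc' : c' = c)
    {p : a ⟶ b} {t : b' ⟶ d'} {s : a' ⟶ c'} {q : c ⟶ d}
    (e : (eqToHom ha ≫ p ≫ eqToHom hb) ≫ t = s ≫ eqToHom hc ≫ q ≫ eqToHom hd) :
    p ≫ eqToHom hb' ≫ t ≫ eqToHom hd' = (eqToHom ha' ≫ s ≫ eqToHom hc') ≫ q := by
  subst ha hb hc hd
  simpa using e

theorem eqToHom_conj_conj {A : Type*} [Category A] {a b a' b' a'' b'' : A} {m : a ⟶ b}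
    (ha : a' = a) (hb : b = b') (ha' : a'' = a') (hb' : b' = b'') (ha'' : a'' = a)
    (hb'' : b = b'') :
    eqToHom ha' ≫ (eqToHom ha ≫ m ≫ eqToHom hb) ≫ eqToHom hb' =
      eqToHom ha'' ≫ m ≫ eqToHom hb'' := by
  subst ha hb ha' hb'
  simp

theorem map_eqToHom_conj {A B : Type*} [Category A] [Category B] (F : A ⥤ B) {a b a' b' : A}
    (m : a ⟶ b) (ha : a' = a) (hb : b = b') :
    F.map (eqToHom ha ≫ m ≫ eqToHom hb) =
      eqToHom (congrArg F.obj ha) ≫ F.map m ≫ eqToHom (congrArg F.obj hb) := by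
  subst ha hb
  simp

theorem natTrans_app_eq_conj {A B : Type*} [Category A] [Category B] {P P' Q Q' : A ⥤ B}
    {a : P ⟶ Q} {b : P' ⟶ Q'} (hQ : Q = Q') (hP : P = P')
    (e : a ≫ eqToHom hQ = eqToHom hP ≫ b) (z : A) :
    a.app z = eqToHom (by rw [hP]) ≫ b.app z ≫ eqToHom (by rw [hQ]) := by
  subst hQ hP
  simp only [eqToHom_refl, Category.comp_id, Category.id_comp] at e
  simp [e]

section CoconeObj

variable {D : Jᵒᵖ ⥤ Cat.{u, u}} {A : Cat.{u, u}}

/-- The value of a weighted cocone at an object. -/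
abbrev coconeObj (α : W ⟶ homInto D A) {j : J} (x : W.obj j) : D.obj (op j) ⥤ A :=
  (α.app j).toFunctor.obj x

/-- The value of a weighted cocone at a morphism. -/
abbrev coconeMap (α : W ⟶ homInto D A) {j : J} {x y : W.obj j} (m : x ⟶ y) :
    coconeObj α x ⟶ coconeObj α y :=
  (α.app j).toFunctor.map m

theorem coconeMap_id (α : W ⟶ homInto D A) {j : J} (x : W.obj j) :
    coconeMap α (𝟙 x) = 𝟙 (coconeObj α x) :=
  (α.app j).toFunctor.map_id x

theorem coconeMap_comp (α : W ⟶ homInto D A) {j : J} {x y z : W.obj j} (m : x ⟶ y)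
    (n : y ⟶ z) : coconeMap α (m ≫ n) = coconeMap α m ≫ coconeMap α n :=
  (α.app j).toFunctor.map_comp m n

theorem coconeObj_map (α : W ⟶ homInto D A) {j k : J} (f : j ⟶ k) (x : W.obj j) :
    coconeObj α ((W.map f).toFunctor.obj x) = act D f ⋙ coconeObj α x :=
  Functor.congr_obj (congrArg Cat.Hom.toFunctor (α.naturality f)) x

theorem coconeObj_map_of_eq (α : W ⟶ homInto D A) {j k : J} {f : j ⟶ k} {x : W.obj j}
    {y : W.obj k} (e : (W.map f).toFunctor.obj x = y) {z z' : D.obj (op k)} (m : z ⟶ z') :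
    (coconeObj α y).map m =
      eqToHom (by rw [← e, coconeObj_map]; rfl) ≫ (coconeObj α x).map ((act D f).map m) ≫
        eqToHom (by rw [← e, coconeObj_map]; rfl) := by
  subst e
  exact Functor.congr_hom (coconeObj_map α f x) m

theorem coconeMap_map_app (α : W ⟶ homInto D A) {j k : J} (f : j ⟶ k) {x y : W.obj j}
    (n : x ⟶ y) (z : D.obj (op k)) :
    (coconeMap α ((W.map f).toFunctor.map n)).app z =
      eqToHom (Functor.congr_obj (coconeObj_map α f x) z) ≫
        (coconeMap α n).app ((act D f).obj z) ≫
          eqToHom (Functor.congr_obj (coconeObj_map α f y).symm z) := by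
  have e := Functor.congr_hom (congrArg Cat.Hom.toFunctor (α.naturality f)) n
  have e' := congrArg (fun τ : coconeObj α _ ⟶ coconeObj α _ => τ.app z) e
  refine e'.trans ((NatTrans.comp_app _ _ _).trans ?_)
  refine congr (congrArg CategoryStruct.comp (eqToHom_app _ _)) ?_
  refine (NatTrans.comp_app _ _ _).trans ?_
  exact congrArg (_ ≫ ·) (eqToHom_app _ _)

theorem cocone_ext {α β : W ⟶ homInto D A}
    (hobj : ∀ {j : J} (x : W.obj j) (z : D.obj (op j)),
      (coconeObj α x).obj z = (coconeObj β x).obj z)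
    (hmap : ∀ {j : J} (x : W.obj j) {z z' : D.obj (op j)} (m : z ⟶ z'),
      (coconeObj α x).map m = eqToHom (hobj x z) ≫ (coconeObj β x).map m ≫
        eqToHom (hobj x z').symm)
    (happ : ∀ {j : J} {x y : W.obj j} (n : x ⟶ y) (z : D.obj (op j)),
      (coconeMap α n).app z = eqToHom (hobj x z) ≫ (coconeMap β n).app z ≫
        eqToHom (hobj y z).symm) : α = β := by
  ext j : 2
  exact Cat.ext (functor_ext₂ (B := D.obj (op j)) (C := A) hobj (fun a _ _ m => hmap a m)
    (fun n b => happ n b))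

end CoconeObj

theorem act_map_congr (D : Jᵒᵖ ⥤ Cat.{u, u}) {i j : J} {f g : i ⟶ j} (e : f = g)
    {z z' : D.obj (op j)} (m : z ⟶ z') :
    (act D f).map m = eqToHom (by rw [e]) ≫ (act D g).map m ≫ eqToHom (by rw [e]) := by
  subst e
  simp

theorem act_id_map (D : Jᵒᵖ ⥤ Cat.{u, u}) {j : J} {z z' : D.obj (op j)} (m : z ⟶ z') :
    (act D (𝟙 j)).map m = eqToHom (act_id_obj D z) ≫ m ≫ eqToHom (act_id_obj D z').symm :=
  Functor.congr_hom (act_id D j) m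

theorem act_map_of_eq_id (D : Jᵒᵖ ⥤ Cat.{u, u}) {j : J} {f : j ⟶ j} (e : f = 𝟙 j)
    {z z' : D.obj (op j)} (m : z ⟶ z') :
    (act D f).map m = eqToHom (by rw [e, act_id_obj]) ≫ m ≫
      eqToHom (by rw [e, act_id_obj]) := by
  subst e
  exact act_id_map D m

theorem act_comp_map (D : Jᵒᵖ ⥤ Cat.{u, u}) {i j k : J} (f : i ⟶ j) (g : j ⟶ k)
    {z z' : D.obj (op k)} (m : z ⟶ z') :
    (act D (f ≫ g)).map m = eqToHom (act_comp_obj D f g z) ≫ (act D f).map ((act D g).map m) ≫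
      eqToHom (act_comp_obj D f g z').symm :=
  Functor.congr_hom (act_comp D f g) m

namespace CodescentData

variable {D : Jᵒᵖ ⥤ Cat.{u, u}}

theorem ext_of_eqToHom {A : Type*} [Category A] {d e : CodescentData D j₀ A}
    (hobj : ∀ c, d.functor.obj c = e.functor.obj c)
    (hmap : ∀ {c c' : D.obj (op j₀)} (m : c ⟶ c'), d.functor.map m =
      eqToHom (hobj c) ≫ e.functor.map m ≫ eqToHom (hobj c').symm)
    (hcell : ∀ {j : J} (f g : j₀ ⟶ j) (z : D.obj (op j)), d.cell f g z rfl rfl =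
      eqToHom (hobj _) ≫ e.cell f g z rfl rfl ≫ eqToHom (hobj _).symm) : d = e := by
  obtain ⟨F, c, _, _, _, _⟩ := d
  obtain ⟨G, c', _, _, _, _⟩ := e
  obtain rfl : F = G := CategoryTheory.Functor.ext hobj (fun _ _ m => hmap m)
  obtain rfl : @c = @c' := by
    funext j f g z _ _ hf hg
    subst hf hg
    simpa using hcell f g z
  rfl

/-- The image of codescent data under a functor. -/
def map {A B : Type*} [Category A] [Category B] (d : CodescentData D j₀ A) (G : A ⥤ B) :
    CodescentData D j₀ B where
  functor := d.functor ⋙ G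
  cell f g z _ _ hf hg := G.map (d.cell f g z hf hg)
  cell_self f z := (congrArg G.map (d.cell_self f z)).trans (G.map_id _)
  cell_comp f g h z := (G.map_comp _ _).symm.trans (congrArg G.map (d.cell_comp f g h z))
  cell_naturality f g _ _ m := (G.map_comp _ _).symm.trans
    ((congrArg G.map (d.cell_naturality f g m)).trans (G.map_comp _ _))
  cell_map f g h z := congrArg G.map (d.cell_map f g h z)

variable {A : Cat.{u, u}} (h : IsIndiscretelyRepresentedBy W x₀)

/-- The weighted cocone corresponding to codescent data. -/
noncomputable def toCocone (d : CodescentData D j₀ A) : W ⟶ homInto D A where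
  app j := Functor.toCatHom (D := D.obj (op j) ⥤ A)
    { obj := fun x => act D (h.point x) ⋙ d.functor
      map := fun {x y} _ =>
        { app := fun z => d.cell (h.point x) (h.point y) z rfl rfl
          naturality := fun _ _ m => d.cell_naturality _ _ m }
      map_id := fun x => by
        ext z
        exact d.cell_self _ z
      map_comp := fun _ _ => by
        ext z
        exact (d.cell_comp _ _ _ z).symm }
  naturality j k f := by
    refine Cat.ext (functor_ext₂ (fun x z => ?_) (fun x z z' m => ?_) (fun {x y} n z => ?_))
    · change d.functor.obj ((act D (h.point ((W.map f).toFunctor.obj x))).obj z) =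
        d.functor.obj ((act D (h.point x)).obj ((act D f).obj z))
      rw [h.point_obj, act_comp_obj]
    · change d.functor.map ((act D (h.point ((W.map f).toFunctor.obj x))).map m) = eqToHom _ ≫
        d.functor.map ((act D (h.point x)).map ((act D f).map m)) ≫ eqToHom _
      rw [act_map_congr D (h.point_obj f x), act_comp_map]
      simp [eqToHom_map]
    · change d.cell (h.point ((W.map f).toFunctor.obj x)) (h.point ((W.map f).toFunctor.obj y)) z
        rfl rfl = eqToHom _ ≫ d.cell (h.point x) (h.point y) ((act D f).obj z) rfl rfl ≫ eqToHom _
      rw [d.cell_map, d.cell_eq_conj (h.point_obj f x) (h.point_obj f y) rfl]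

-- As `W j` is thin, the value of a cocone on a morphism depends only on its endpoints.
include h in
theorem coconeMap_eq_conj (α : W ⟶ homInto D A) {j : J} {x y x' y' : W.obj j} (ex : x = x')
    (ey : y = y') (m : x ⟶ y) (m' : x' ⟶ y') (z : D.obj (op j)) :
    (coconeMap α m).app z = eqToHom (by rw [ex]) ≫ (coconeMap α m').app z ≫
      eqToHom (by rw [ey]) := by
  subst ex ey
  have := h.isThin
  rw [Subsingleton.elim m m']
  simp

/-- The codescent data corresponding to a weighted cocone. -/
noncomputable def ofCocone (α : W ⟶ homInto D A) : CodescentData D j₀ A where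
  functor := coconeObj α x₀
  cell {j} f g z c c' hf hg :=
    eqToHom ((congrArg _ hf.symm).trans (Functor.congr_obj (coconeObj_map α f x₀) z).symm) ≫
      (coconeMap α (h.hom ((W.map f).toFunctor.obj x₀) ((W.map g).toFunctor.obj x₀))).app z ≫
        eqToHom ((Functor.congr_obj (coconeObj_map α g x₀) z).trans (congrArg _ hg))
  cell_self f z := by
    have := h.isThin
    rw [Subsingleton.elim (h.hom _ _) (𝟙 _), coconeMap_id]
    simp
  cell_comp f g k z := by
    have := h.isThin
    rw [← Subsingleton.elim (h.hom ((W.map f).toFunctor.obj x₀) ((W.map g).toFunctor.obj x₀) ≫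
      h.hom ((W.map g).toFunctor.obj x₀) ((W.map k).toFunctor.obj x₀)) (h.hom _ _), coconeMap_comp]
    simp
  cell_naturality f g z z' m := by
    have e := (coconeMap α
      (h.hom ((W.map f).toFunctor.obj x₀) ((W.map g).toFunctor.obj x₀))).naturality m
    rw [Functor.congr_hom (coconeObj_map α f x₀) m, Functor.congr_hom (coconeObj_map α g x₀) m] at e
    exact eqToHom_conj_square _ _ _ _ _ _ _ _ e
  cell_map f g k z := by
    rw [coconeMap_eq_conj h α (x := (W.map (f ≫ k)).toFunctor.obj x₀)
      (y := (W.map (g ≫ k)).toFunctor.obj x₀) (by simp) (by simp) _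
        ((W.map k).toFunctor.map (h.hom ((W.map f).toFunctor.obj x₀) ((W.map g).toFunctor.obj x₀))),
      coconeMap_map_app]
    simp

/-- Each `x` is the image of `x₀` under `W (h.point x)`, so strict naturality recovers the cocone
from its value at `x₀` and its cells. -/
theorem toCocone_ofCocone (α : W ⟶ homInto D A) : toCocone h (ofCocone h α) = α := by
  have hobj {j : J} (x : W.obj j) (z : D.obj (op j)) :
      (coconeObj (toCocone h (ofCocone h α)) x).obj z = (coconeObj α x).obj z := by
    have e := Functor.congr_obj (coconeObj_map α (h.point x) x₀) z
    rw [h.map_point_obj] at e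
    exact e.symm
  refine cocone_ext hobj (fun {j} x z z' m => ?_) (fun {j x y} n z => ?_)
  · rw [coconeObj_map_of_eq α (h.map_point_obj x) m]
    exact (eq_eqToHom_conj _ rfl rfl).trans (eqToHom_conj_conj _ _ _ _ _ _).symm
  · change eqToHom _ ≫ (coconeMap α (h.hom _ _)).app z ≫ eqToHom _ = _
    rw [coconeMap_eq_conj h α (h.map_point_obj x) (h.map_point_obj y) _ n]
    exact eqToHom_conj_conj _ _ _ _ _ _

theorem ofCocone_toCocone (d : CodescentData D j₀ A) : ofCocone h (toCocone h d) = d := by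
  have hobj (c : D.obj (op j₀)) : (ofCocone h (toCocone h d)).functor.obj c =
      d.functor.obj c := by
    change d.functor.obj ((act D (h.point x₀)).obj c) = _
    rw [h.point_self, act_id_obj]
  refine ext_of_eqToHom hobj (fun {c c'} m => ?_) (fun {j} f g z => ?_)
  · change d.functor.map ((act D (h.point x₀)).map m) = _
    rw [act_map_of_eq_id D h.point_self, map_eqToHom_conj]
    rfl
  · change eqToHom _ ≫ d.cell (h.point ((W.map f).toFunctor.obj x₀))
      (h.point ((W.map g).toFunctor.obj x₀)) z rfl rfl ≫ eqToHom _ = _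
    rw [d.cell_eq_conj (h.point_map_obj f) (h.point_map_obj g) rfl rfl rfl rfl rfl]
    exact eqToHom_conj_conj _ _ _ _ _ _

theorem desc_map (G : CodescentCat D j₀ ⥤ A) :
    CodescentCat.desc ((CodescentCat.data D j₀).map G) = G := by
  refine CodescentCat.hom_ext (fun _ => rfl) (fun _ => ?_) (fun _ _ _ => ?_)
  · exact eq_eqToHom_conj _ _ _
  · exact eq_eqToHom_conj _ _ _

end CodescentData

variable (h : IsIndiscretelyRepresentedBy W x₀) (D : Jᵒᵖ ⥤ Cat.{u, u})

/-- The colimit cocone that exhibits the codescent category as a weighted colimit. -/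
noncomputable def codescentCocone : W ⟶ homInto D (Cat.of (CodescentCat D j₀)) :=
  (CodescentCat.data D j₀).toCocone (A := Cat.of (CodescentCat D j₀)) h

/-! ### Fullness of the comparison: modifications of cocones come from natural transformations -/

section Modification

variable {A : Cat.{u, u}} {G G' : CodescentCat D j₀ ⥤ A}
  (μ : (cocomparison (codescentCocone h D) A).obj G ⟶ (cocomparison (codescentCocone h D) A).obj G')

/-- The components of a modification between cocones induced by functors. -/
noncomputable def modificationComp {j : J} (x : W.obj j) (z : D.obj (op j)) :
    G.obj ((CodescentCat.data D j₀).functor.obj ((act D (h.point x)).obj z)) ⟶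
      G'.obj ((CodescentCat.data D j₀).functor.obj ((act D (h.point x)).obj z)) :=
  NatTrans.app ((Modification.app (InducedCategory.Hom.hom μ) j).app x) z

theorem modificationComp_base {j : J} (x : W.obj j) {z z' : D.obj (op j)} (m : z ⟶ z') :
    G.map ((CodescentCat.data D j₀).functor.map ((act D (h.point x)).map m)) ≫
        modificationComp h D μ x z' =
      modificationComp h D μ x z ≫
        G'.map ((CodescentCat.data D j₀).functor.map ((act D (h.point x)).map m)) :=
  NatTrans.naturality ((Modification.app (InducedCategory.Hom.hom μ) j).app x) m

theorem modificationComp_cell {j : J} (x y : W.obj j) (z : D.obj (op j)) :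
    G.map ((CodescentCat.data D j₀).cell (h.point x) (h.point y) z rfl rfl) ≫
        modificationComp h D μ y z =
      modificationComp h D μ x z ≫
        G'.map ((CodescentCat.data D j₀).cell (h.point x) (h.point y) z rfl rfl) :=
  NatTrans.congr_app ((Modification.app (InducedCategory.Hom.hom μ) j).naturality (h.hom x y)) z

theorem modificationComp_map {j k : J} (f : j ⟶ k) (x : W.obj j) (z : D.obj (op k)) :
    modificationComp h D μ ((W.map f).toFunctor.obj x) z =
      eqToHom (by rw [h.point_obj, act_comp_obj]) ≫ modificationComp h D μ x ((act D f).obj z) ≫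
        eqToHom (by rw [h.point_obj, act_comp_obj]) := by
  have e := Modification.naturality (InducedCategory.Hom.hom μ) f x
  simp only [cocomparison, toPseudonatural, eqToIso.hom, eqToHom_app] at e
  exact natTrans_app_eq_conj _ _ e z

theorem modificationComp_congr {j : J} {x y : W.obj j} (e : x = y) (z : D.obj (op j)) :
    modificationComp h D μ x z = eqToHom (by rw [e]) ≫ modificationComp h D μ y z ≫
      eqToHom (by rw [e]) := by
  subst e
  simp

/-- The components of the natural transformation that induces a modification. -/
noncomputable def modificationApp (c : D.obj (op j₀)) :
    G.obj ((CodescentCat.data D j₀).functor.obj c) ⟶ G'.obj ((CodescentCat.data D j₀).functor.obj c) :=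
  eqToHom (by rw [h.point_self, act_id_obj]) ≫ modificationComp h D μ x₀ c ≫
    eqToHom (by rw [h.point_self, act_id_obj])

/-- Naturality in `J` along `h.point x` reduces every component to the one at `x₀`, which is
therefore the only candidate for the natural transformation. -/
theorem modificationComp_eq {j : J} (x : W.obj j) (z : D.obj (op j)) :
    modificationComp h D μ x z = modificationApp h D μ ((act D (h.point x)).obj z) := by
  rw [modificationComp_congr h D μ (h.map_point_obj x).symm, modificationComp_map,
    eqToHom_conj_conj]
  rfl

theorem modificationApp_base {c c' : D.obj (op j₀)} (m : c ⟶ c') :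
    G.map ((CodescentCat.data D j₀).functor.map m) ≫ modificationApp h D μ c' =
      modificationApp h D μ c ≫ G'.map ((CodescentCat.data D j₀).functor.map m) := by
  have e := modificationComp_base h D μ x₀ m
  rw [act_map_of_eq_id D h.point_self, map_eqToHom_conj, map_eqToHom_conj, map_eqToHom_conj] at e
  exact eqToHom_conj_square _ _ _ _ _ _ _ _ e

theorem modificationApp_cell {j : J} (f g : j₀ ⟶ j) (z : D.obj (op j)) :
    G.map ((CodescentCat.data D j₀).cell f g z rfl rfl) ≫ modificationApp h D μ _ =
      modificationApp h D μ _ ≫ G'.map ((CodescentCat.data D j₀).cell f g z rfl rfl) := by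
  have e := modificationComp_cell h D μ ((W.map f).toFunctor.obj x₀) ((W.map g).toFunctor.obj x₀) z
  rw [modificationComp_eq, modificationComp_eq] at e
  -- The types of the cells depend on these points, so the points are replaced by variables before
  -- being identified with `f` and `g`.
  generalize hf : h.point ((W.map f).toFunctor.obj x₀) = f' at e
  generalize hg : h.point ((W.map g).toFunctor.obj x₀) = g' at e
  rw [h.point_map_obj] at hf hg
  subst hf hg
  exact e

end Modification

theorem isWeightedColimit_codescentCocone : IsWeightedColimit (codescentCocone h D) := by
  intro A
  refine ⟨⟨fun {G G'} μ => ?_⟩, ⟨fun {G G'} β β' e => ?_⟩, fun G G' e => ?_, fun α => ?_⟩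
  · refine ⟨CodescentCat.natTransMk (modificationApp h D μ) (modificationApp_base h D μ)
      (modificationApp_cell h D μ), ?_⟩
    refine InducedCategory.hom_ext (Modification.ext (funext fun j => NatTrans.ext (funext fun x =>
      NatTrans.ext (funext fun z => ?_))))
    exact (modificationComp_eq h D μ x z).symm
  · refine NatTrans.ext (funext fun c => ?_)
    have key (c : D.obj (op j₀)) : β.app ⟨(act D (h.point x₀)).obj c⟩ =
        β'.app ⟨(act D (h.point x₀)).obj c⟩ :=
      congrArg (fun μ => NatTrans.app ((Modification.app (InducedCategory.Hom.hom μ) j₀).app x₀) c) e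
    have hc := key c.as
    rw [h.point_self, act_id_obj] at hc
    exact hc
  · have e' := congrArg (CodescentData.ofCocone h) e
    -- The cocone induced by `G` is, by definition, `toCocone` of the image of the universal data,
    -- so the data can be read off from it; `desc` then recovers `G`.
    have key (G : CodescentCat D j₀ ⥤ A) :
        CodescentData.ofCocone h ((cocomparison (codescentCocone h D) A).obj G) =
          (CodescentCat.data D j₀).map G :=
      CodescentData.ofCocone_toCocone h ((CodescentCat.data D j₀).map G)
    replace e' := (key G).symm.trans (e'.trans (key G'))
    rw [← CodescentData.desc_map G, ← CodescentData.desc_map G']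
    exact congrArg CodescentCat.desc e'
  · exact ⟨CodescentCat.desc (CodescentData.ofCocone h α),
      CodescentData.toCocone_ofCocone h α⟩

end Cocones

end WeightedColimits

/-! ### Functoriality of codescent categories, and products of diagrams -/

namespace WeightedColimits

section Functoriality

variable {J : Type} [Category.{0} J] {j₀ : J}

/-- The codescent data induced by a morphism of diagrams. -/
def CodescentData.precomp {D E : Jᵒᵖ ⥤ Cat.{u, u}} (φ : D ⟶ E) {A : Type*} [Category A]
    (d : CodescentData E j₀ A) : CodescentData D j₀ A where
  functor := (φ.app (op j₀)).toFunctor ⋙ d.functor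
  cell {j} f g z _ _ hf hg := d.cell f g ((φ.app (op j)).toFunctor.obj z)
    ((act_naturality_obj φ f z).trans (congrArg _ hf))
    ((act_naturality_obj φ g z).trans (congrArg _ hg))
  cell_self f _ := d.cell_self_eq f _ _ _
  cell_comp f g h _ := d.cell_comp_cell f g h _ _ _ _ _
  cell_naturality {j} f g _ _ m :=
    d.map_comp_cell f g ((φ.app (op j)).toFunctor.map m) _ _ _ _
      (Functor.hcongr_hom (act_naturality φ f).symm m)
      (Functor.hcongr_hom (act_naturality φ g).symm m)
  cell_map _ _ h z := d.cell_eq_cell h _ (act_naturality_obj φ h z) rfl rfl _ _ _ _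

variable (j₀) in
/-- The functor that sends a diagram to its codescent category. -/
def codescentFunctor : (Jᵒᵖ ⥤ Cat.{u, u}) ⥤ Cat.{u, u} where
  obj D := Cat.of (CodescentCat D j₀)
  map {_ E} φ := (CodescentCat.desc ((CodescentCat.data E j₀).precomp φ)).toCatHom
  map_id _ := Cat.ext (CodescentCat.hom_ext (fun _ => rfl) (fun _ => eq_eqToHom_conj _ _ _)
    (fun _ _ _ => eq_eqToHom_conj _ _ _))
  map_comp _ _ := Cat.ext (CodescentCat.hom_ext (fun _ => rfl) (fun _ => eq_eqToHom_conj _ _ _)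
    (fun _ _ _ => eq_eqToHom_conj _ _ _))

/-- Codescent categories as a functorial choice of weighted colimits. -/
noncomputable def weightedColimitFunctor {W : J ⥤ Cat.{u, u}} {x₀ : W.obj j₀}
    (h : IsIndiscretelyRepresentedBy W x₀) : WeightedColimitFunctor W where
  functor := codescentFunctor j₀
  cocone D := codescentCocone h D
  isWeightedColimit D := isWeightedColimit_codescentCocone h D
  naturality {D E} φ := by
    have hobj {j : J} (x : W.obj j) (z : D.obj (op j)) :
        (CodescentCat.data E j₀).functor.obj
          ((φ.app (op j₀)).toFunctor.obj ((act D (h.point x)).obj z)) =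
        (CodescentCat.data E j₀).functor.obj
          ((act E (h.point x)).obj ((φ.app (op j)).toFunctor.obj z)) := by
      rw [act_naturality_obj]
    refine cocone_ext hobj (fun {j} x z z' m => ?_) (fun {j x y} n z => ?_)
    · change (CodescentCat.data E j₀).functor.map
          ((φ.app (op j₀)).toFunctor.map ((act D (h.point x)).map m)) = eqToHom _ ≫
        (CodescentCat.data E j₀).functor.map
          ((act E (h.point x)).map ((φ.app (op j)).toFunctor.map m)) ≫ eqToHom _
      have e := Functor.congr_hom (act_naturality φ (h.point x)) m
      simp only [Functor.comp_map] at e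
      rw [e, map_eqToHom_conj]
    · exact (CodescentCat.data E j₀).cell_eq_conj rfl rfl rfl _ _ rfl rfl

end Functoriality

section Products

variable {J : Type} [Category.{0} J]

/-- The pointwise product of two diagrams of categories. -/
def prodDiagram (D E : Jᵒᵖ ⥤ Cat.{u, u}) : Jᵒᵖ ⥤ Cat.{u, u} where
  obj j := Cat.of (D.obj j × E.obj j)
  map f := ((D.map f).toFunctor.prod (E.map f).toFunctor).toCatHom
  map_id j := by
    rw [D.map_id, E.map_id]
    rfl
  map_comp f g := by
    rw [D.map_comp, E.map_comp]
    rfl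

variable {D E : Jᵒᵖ ⥤ Cat.{u, u}}

variable (D E) in
/-- The first projection from the product of two diagrams. -/
def prodDiagramFst : prodDiagram D E ⟶ D where
  app j := (CategoryTheory.Prod.fst (D.obj j) (E.obj j)).toCatHom
  naturality _ _ _ := rfl

variable (D E) in
/-- The second projection from the product of two diagrams. -/
def prodDiagramSnd : prodDiagram D E ⟶ E where
  app j := (CategoryTheory.Prod.snd (D.obj j) (E.obj j)).toCatHom
  naturality _ _ _ := rfl

variable (D E) in
/-- The product of two diagrams is their product in the category of diagrams. -/
def isLimitProdDiagram :
    IsLimit (BinaryFan.mk (prodDiagramFst D E) (prodDiagramSnd D E)) :=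
  BinaryFan.isLimitMk
    (fun s =>
      { app := fun j => ((s.fst.app j).toFunctor.prod' (s.snd.app j).toFunctor).toCatHom
        naturality := fun i j f => by
          have h₁ := congrArg Cat.Hom.toFunctor (s.fst.naturality f)
          have h₂ := congrArg Cat.Hom.toFunctor (s.snd.naturality f)
          exact Cat.ext (congrArg₂ Functor.prod' h₁ h₂) })
    (fun _ => by
      ext j : 2
      rfl)
    (fun _ => by
      ext j : 2
      rfl)
    (fun s m h₁ h₂ => by
      ext j : 2
      change m.app j = ((s.fst.app j).toFunctor.prod' (s.snd.app j).toFunctor).toCatHom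
      rw [← h₁, ← h₂]
      rfl)

end Products

end WeightedColimits

/-! ### Simplicial frames, and generators of the codescent category of a product -/

namespace WeightedColimits

/-- A terminal object `j₀` of `J`, together with objects and arrows of `J` that behave as the
`1`-simplex, the `2`-simplex and the maps between them. -/
structure SimplicialFrame {J : Type} [Category.{0} J] (j₀ : J) where
  /-- The chosen object is terminal. -/
  isTerminal : IsTerminal j₀
  /-- The object of edges. -/
  j₁ : J
  /-- The object of triangles. -/
  j₂ : J
  /-- The first vertex of an edge. -/
  p₀ : j₀ ⟶ j₁
  /-- The second vertex of an edge. -/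
  p₁ : j₀ ⟶ j₁
  /-- The first edge of a triangle. -/
  d₀₁ : j₁ ⟶ j₂
  /-- The second edge of a triangle. -/
  d₁₂ : j₁ ⟶ j₂
  /-- The long edge of a triangle. -/
  d₀₂ : j₁ ⟶ j₂
  /-- The map that collapses the first edge of a triangle. -/
  s₀ : j₂ ⟶ j₁
  /-- The map that collapses the second edge of a triangle. -/
  s₁ : j₂ ⟶ j₁
  p₀_d₀₂ : p₀ ≫ d₀₂ = p₀ ≫ d₀₁
  p₁_d₀₁ : p₁ ≫ d₀₁ = p₀ ≫ d₁₂
  p₁_d₀₂ : p₁ ≫ d₀₂ = p₁ ≫ d₁₂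
  d₀₁_s₀ : d₀₁ ≫ s₀ = isTerminal.from j₁ ≫ p₀
  d₁₂_s₀ : d₁₂ ≫ s₀ = 𝟙 j₁
  d₀₂_s₀ : d₀₂ ≫ s₀ = 𝟙 j₁
  d₀₁_s₁ : d₀₁ ≫ s₁ = 𝟙 j₁
  d₁₂_s₁ : d₁₂ ≫ s₁ = isTerminal.from j₁ ≫ p₁
  d₀₂_s₁ : d₀₂ ≫ s₁ = 𝟙 j₁
  exists_edge {j : J} (f g : j₀ ⟶ j) :
    ∃ h : j₁ ⟶ j, (p₀ ≫ h = f ∧ p₁ ≫ h = g) ∨ (p₀ ≫ h = g ∧ p₁ ≫ h = f)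

section Frame

open SimplexCategory Simplicial

/-- The simplices of dimension at most two form a frame in `Δ₂`. -/
def truncatedSimplicialFrame : SimplicialFrame (truncatedMk 0 (by decide)) where
  isTerminal := isTerminalTruncatedZero
  j₁ := truncatedMk 1 (by decide)
  j₂ := truncatedMk 2 (by decide)
  p₀ := simplexPoint _ 0
  p₁ := simplexPoint _ 1
  -- The first argument is the truncation level. `δ` is indexed by the omitted vertex, so the edge
  -- `01` is `δ` at `2`; `σ` is indexed by the repeated vertex.
  d₀₁ := Truncated.δ 2 2
  d₁₂ := Truncated.δ 2 0
  d₀₂ := Truncated.δ 2 1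
  s₀ := Truncated.σ 2 0
  s₁ := Truncated.σ 2 1
  p₀_d₀₂ := by decide
  p₁_d₀₁ := by decide
  p₁_d₀₂ := by decide
  d₀₁_s₀ := by decide
  d₁₂_s₀ := by decide
  d₀₂_s₀ := by decide
  d₀₁_s₁ := by decide
  d₁₂_s₁ := by decide
  d₀₂_s₁ := by decide
  exists_edge := exists_edge

end Frame

section ProdCells

variable {J : Type} [Category.{0} J] {j₀ : J} (D E : Jᵒᵖ ⥤ Cat.{u, u})

/-- The object of the codescent category of a product given by a pair of objects. -/
abbrev pairObj (c : D.obj (op j₀)) (e : E.obj (op j₀)) : CodescentCat (prodDiagram D E) j₀ :=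
  ⟨(c, e)⟩

variable {D E}

/-- The morphism of the codescent category of a product given by a pair of morphisms. -/
def pairMap {c c' : D.obj (op j₀)} {e e' : E.obj (op j₀)} (m : c ⟶ c') (n : e ⟶ e') :
    pairObj D E c e ⟶ pairObj D E c' e' :=
  (CodescentCat.data (prodDiagram D E) j₀).functor.map
    (X := (show (prodDiagram D E).obj (op j₀) from (c, e)))
    (Y := (show (prodDiagram D E).obj (op j₀) from (c', e'))) (Prod.mkHom m n)

theorem pairMap_comp {c c' c'' : D.obj (op j₀)} {e e' e'' : E.obj (op j₀)} (m : c ⟶ c')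
    (m' : c' ⟶ c'') (n : e ⟶ e') (n' : e' ⟶ e'') :
    pairMap m n ≫ pairMap m' n' = pairMap (m ≫ m') (n ≫ n') :=
  ((CodescentCat.data (prodDiagram D E) j₀).functor.map_comp
    (X := (show (prodDiagram D E).obj (op j₀) from (c, e)))
    (Y := (show (prodDiagram D E).obj (op j₀) from (c', e')))
    (Z := (show (prodDiagram D E).obj (op j₀) from (c'', e'')))
    (Prod.mkHom m n) (Prod.mkHom m' n')).symm

/-- The cell of the codescent category of a product given by a pair of objects. -/
def pairCell {j : J} (f g : j₀ ⟶ j) (z : D.obj (op j)) (w : E.obj (op j))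
    {c c' : D.obj (op j₀)} {e e' : E.obj (op j₀)}
    (hf : (act D f).obj z = c) (hg : (act D g).obj z = c')
    (kf : (act E f).obj w = e) (kg : (act E g).obj w = e') :
    pairObj D E c e ⟶ pairObj D E c' e' :=
  (CodescentCat.data (prodDiagram D E) j₀).cell f g
    (show (prodDiagram D E).obj (op j) from (z, w))
    (c := (show (prodDiagram D E).obj (op j₀) from (c, e)))
    (c' := (show (prodDiagram D E).obj (op j₀) from (c', e')))
    (Prod.ext hf kf) (Prod.ext hg kg)

theorem pairCell_self {j : J} (f : j₀ ⟶ j) (z : D.obj (op j)) (w : E.obj (op j))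
    {c : D.obj (op j₀)} {e : E.obj (op j₀)} (hf hg : (act D f).obj z = c)
    (kf kg : (act E f).obj w = e) : pairCell f f z w hf hg kf kg = 𝟙 _ :=
  CodescentData.cell_self_eq _ _ _ _ _

theorem pairCell_comp {j : J} (f g h : j₀ ⟶ j) (z : D.obj (op j)) (w : E.obj (op j))
    {c c' c'' : D.obj (op j₀)} {e e' e'' : E.obj (op j₀)}
    (hf : (act D f).obj z = c) (hg hg' : (act D g).obj z = c') (hh : (act D h).obj z = c'')
    (kf : (act E f).obj w = e) (kg kg' : (act E g).obj w = e') (kh : (act E h).obj w = e'') :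
    pairCell f g z w hf hg kf kg ≫ pairCell g h z w hg' hh kg' kh =
      pairCell f h z w hf hh kf kh :=
  CodescentData.cell_comp_cell _ _ _ _ _ _ _ _ _

theorem pairMap_comp_pairCell {j : J} (f g : j₀ ⟶ j) {z z' : D.obj (op j)} (m : z ⟶ z')
    {w w' : E.obj (op j)} (n : w ⟶ w')
    {c c' d d' : D.obj (op j₀)} {e e' b b' : E.obj (op j₀)}
    (hf : (act D f).obj z = c) (hg : (act D g).obj z = c')
    (hf' : (act D f).obj z' = d) (hg' : (act D g).obj z' = d')
    (kf : (act E f).obj w = e) (kg : (act E g).obj w = e')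
    (kf' : (act E f).obj w' = b) (kg' : (act E g).obj w' = b')
    {p : c ⟶ d} {p' : c' ⟶ d'} {q : e ⟶ b} {q' : e' ⟶ b'}
    (hp : (act D f).map m ≍ p) (hp' : (act D g).map m ≍ p')
    (hq : (act E f).map n ≍ q) (hq' : (act E g).map n ≍ q') :
    pairMap p q ≫ pairCell f g z' w' hf' hg' kf' kg' =
      pairCell f g z w hf hg kf kg ≫ pairMap p' q' := by
  subst hf hg hf' hg' kf kg kf' kg'
  obtain rfl := eq_of_heq hp
  obtain rfl := eq_of_heq hp'
  obtain rfl := eq_of_heq hq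
  obtain rfl := eq_of_heq hq'
  exact (CodescentCat.data (prodDiagram D E) j₀).cell_naturality f g
    (z := (show (prodDiagram D E).obj (op j) from (z, w)))
    (z' := (show (prodDiagram D E).obj (op j) from (z', w'))) (Prod.mkHom m n)

theorem pairCell_eq {j k : J} {f g : j₀ ⟶ j} (h : j ⟶ k) {f' g' : j₀ ⟶ k} (z : D.obj (op k))
    (w : E.obj (op k)) {z' : D.obj (op j)} {w' : E.obj (op j)} (hz : (act D h).obj z = z')
    (hw : (act E h).obj w = w') (ef : f ≫ h = f') (eg : g ≫ h = g')
    {c c' : D.obj (op j₀)} {e e' : E.obj (op j₀)}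
    (hf : (act D f).obj z' = c) (hg : (act D g).obj z' = c')
    (kf : (act E f).obj w' = e) (kg : (act E g).obj w' = e')
    (hf' : (act D f').obj z = c) (hg' : (act D g').obj z = c')
    (kf' : (act E f').obj w = e) (kg' : (act E g').obj w = e') :
    pairCell f g z' w' hf hg kf kg = pairCell f' g' z w hf' hg' kf' kg' :=
  CodescentData.cell_eq_cell _ h _ (Prod.ext hz hw) ef eg _ _ _ _

end ProdCells

end WeightedColimits

/-! ### Reduction to edges, and interchange of the two factors -/

namespace WeightedColimits

section Frame

variable {J : Type} [Category.{0} J] {j₀ : J}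

theorem act_comp_act_of_isTerminal (D : Jᵒᵖ ⥤ Cat.{u, u}) (T : IsTerminal j₀) {j : J}
    (f : j₀ ⟶ j) : act D (T.from j) ⋙ act D f = 𝟭 _ := by
  rw [← act_comp, T.hom_ext (f ≫ T.from j) (𝟙 j₀), act_id]

theorem act_act_obj_of_isTerminal (D : Jᵒᵖ ⥤ Cat.{u, u}) (T : IsTerminal j₀) {j : J}
    (f : j₀ ⟶ j) (c : D.obj (op j₀)) : (act D f).obj ((act D (T.from j)).obj c) = c :=
  Functor.congr_obj (act_comp_act_of_isTerminal D T f) c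

theorem act_act_map_of_isTerminal (D : Jᵒᵖ ⥤ Cat.{u, u}) (T : IsTerminal j₀) {j : J}
    (f : j₀ ⟶ j) {c c' : D.obj (op j₀)} (m : c ⟶ c') :
    (act D f).map ((act D (T.from j)).map m) ≍ m :=
  Functor.hcongr_hom (act_comp_act_of_isTerminal D T f) m

theorem act_from_obj (D : Jᵒᵖ ⥤ Cat.{u, u}) (T : IsTerminal j₀) {j k : J} (h : j ⟶ k)
    (c : D.obj (op j₀)) :
    (act D h).obj ((act D (T.from k)).obj c) = (act D (T.from j)).obj c := by
  rw [← act_comp_obj, T.hom_ext (h ≫ T.from k) (T.from j)]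

theorem act_map_id_heq (D : Jᵒᵖ ⥤ Cat.{u, u}) {i j : J} (f : i ⟶ j) {z : D.obj (op j)}
    {c : D.obj (op i)} (e : (act D f).obj z = c) : (act D f).map (𝟙 z) ≍ 𝟙 c := by
  subst e
  rw [CategoryTheory.Functor.map_id]

namespace SimplicialFrame

variable (S : SimplicialFrame j₀)

section Induction

variable {D : Jᵒᵖ ⥤ Cat.{u, u}}

/-- To prove a property of all morphisms of the codescent category, it suffices to consider the
generators given by edges, composites and inverses. -/
theorem induction {P : ∀ {a b : CodescentCat D j₀}, (a ⟶ b) → Prop}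
    (base : ∀ {c c' : D.obj (op j₀)} (m : c ⟶ c'), P ((CodescentCat.data D j₀).functor.map m))
    (cell : ∀ z : D.obj (op S.j₁), P ((CodescentCat.data D j₀).cell S.p₀ S.p₁ z rfl rfl))
    (comp : ∀ {a b c : CodescentCat D j₀} (m : a ⟶ b) (n : b ⟶ c), P m → P n → P (m ≫ n))
    (inv : ∀ {a b : CodescentCat D j₀} (m : a ⟶ b) (n : b ⟶ a), m ≫ n = 𝟙 a → n ≫ m = 𝟙 b →
      P m → P n)
    {a b : CodescentCat D j₀} (m : a ⟶ b) : P m := by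
  have edge (z : D.obj (op S.j₁)) {c c' : D.obj (op j₀)} (h₀ : (act D S.p₀).obj z = c)
      (h₁ : (act D S.p₁).obj z = c') : P ((CodescentCat.data D j₀).cell S.p₀ S.p₁ z h₀ h₁) := by
    subst h₀ h₁
    exact cell z
  induction m using CodescentCat.induction with
  | base m => exact base m
  | cell f g z =>
    -- By `cell_map`, the cell at `f`, `g` is the cell of an edge if the edge runs from `f` to `g`,
    -- and the inverse of one otherwise.
    obtain ⟨h, ⟨hf, hg⟩ | ⟨hg, hf⟩⟩ := S.exists_edge f g
    · have hf' : (act D S.p₀).obj ((act D h).obj z) = (act D f).obj z := by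
        rw [← hf, act_comp_obj]
      have hg' : (act D S.p₁).obj ((act D h).obj z) = (act D g).obj z := by
        rw [← hg, act_comp_obj]
      rw [← (CodescentCat.data D j₀).cell_eq_cell h z rfl hf hg hf' hg' rfl rfl]
      exact edge _ _ _
    · have hf' : (act D S.p₁).obj ((act D h).obj z) = (act D f).obj z := by
        rw [← hf, act_comp_obj]
      have hg' : (act D S.p₀).obj ((act D h).obj z) = (act D g).obj z := by
        rw [← hg, act_comp_obj]
      rw [← (CodescentCat.data D j₀).cell_eq_cell h z rfl hf hg hf' hg' rfl rfl]
      refine inv _ _ ?_ ?_ (edge ((act D h).obj z) hg' hf')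
      · rw [CodescentData.cell_comp_cell, CodescentData.cell_self_eq]
      · rw [CodescentData.cell_comp_cell, CodescentData.cell_self_eq]
  | comp m n hm hn => exact comp m n hm hn

include S in
theorem hom_ext {A : Type*} [Category A] {G H : CodescentCat D j₀ ⥤ A}
    (hobj : ∀ c, G.obj c = H.obj c)
    (hbase : ∀ {c c' : D.obj (op j₀)} (m : c ⟶ c'),
      G.map ((CodescentCat.data D j₀).functor.map m) =
        eqToHom (hobj _) ≫ H.map ((CodescentCat.data D j₀).functor.map m) ≫
          eqToHom (hobj _).symm)
    (hcell : ∀ z : D.obj (op S.j₁),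
      G.map ((CodescentCat.data D j₀).cell S.p₀ S.p₁ z rfl rfl) = eqToHom (hobj _) ≫
        H.map ((CodescentCat.data D j₀).cell S.p₀ S.p₁ z rfl rfl) ≫ eqToHom (hobj _).symm) :
    G = H := by
  refine CategoryTheory.Functor.ext hobj (fun a b m => ?_)
  induction m using S.induction with
  | base m => exact hbase m
  | cell z => exact hcell z
  | comp m n hm hn => simp [hm, hn]
  | @inv a b m n h h' hm =>
    have e : G.map m ≫ eqToHom (hobj b) ≫ H.map n ≫ eqToHom (hobj a).symm = 𝟙 _ := by
      rw [hm]
      simp [← Functor.map_comp_assoc, h]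
    have e' : G.map n ≫ G.map m = 𝟙 _ := by rw [← Functor.map_comp, h', CategoryTheory.Functor.map_id]
    rw [← Category.comp_id (G.map n), ← e, reassoc_of% e']

end Induction

variable {D E : Jᵒᵖ ⥤ Cat.{u, u}}

/-- All three edges are faces of one triangle `(Z, V)`, so `cell_map` turns them into cells between
its vertices, which compose by `cell_comp`. -/
theorem triangle {Z : D.obj (op S.j₂)} {V : E.obj (op S.j₂)} {z₀₁ z₁₂ z₀₂ : D.obj (op S.j₁)}
    {v₀₁ v₁₂ v₀₂ : E.obj (op S.j₁)} (h₀₁ : (act D S.d₀₁).obj Z = z₀₁)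
    (h₁₂ : (act D S.d₁₂).obj Z = z₁₂) (h₀₂ : (act D S.d₀₂).obj Z = z₀₂)
    (k₀₁ : (act E S.d₀₁).obj V = v₀₁) (k₁₂ : (act E S.d₁₂).obj V = v₁₂)
    (k₀₂ : (act E S.d₀₂).obj V = v₀₂) {c₀ c₁ c₂ : D.obj (op j₀)} {e₀ e₁ e₂ : E.obj (op j₀)}
    (hf : (act D S.p₀).obj z₀₁ = c₀) (hg : (act D S.p₁).obj z₀₁ = c₁)
    (hf' : (act D S.p₀).obj z₁₂ = c₁) (hg' : (act D S.p₁).obj z₁₂ = c₂)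
    (hf'' : (act D S.p₀).obj z₀₂ = c₀) (hg'' : (act D S.p₁).obj z₀₂ = c₂)
    (kf : (act E S.p₀).obj v₀₁ = e₀) (kg : (act E S.p₁).obj v₀₁ = e₁)
    (kf' : (act E S.p₀).obj v₁₂ = e₁) (kg' : (act E S.p₁).obj v₁₂ = e₂)
    (kf'' : (act E S.p₀).obj v₀₂ = e₀) (kg'' : (act E S.p₁).obj v₀₂ = e₂) :
    pairCell S.p₀ S.p₁ z₀₁ v₀₁ hf hg kf kg ≫ pairCell S.p₀ S.p₁ z₁₂ v₁₂ hf' hg' kf' kg' =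
      pairCell S.p₀ S.p₁ z₀₂ v₀₂ hf'' hg'' kf'' kg'' := by
  have a₀ : (act D (S.p₀ ≫ S.d₀₁)).obj Z = c₀ := by rw [act_comp_obj, h₀₁, hf]
  have a₁ : (act D (S.p₀ ≫ S.d₁₂)).obj Z = c₁ := by rw [act_comp_obj, h₁₂, hf']
  have a₂ : (act D (S.p₁ ≫ S.d₁₂)).obj Z = c₂ := by rw [act_comp_obj, h₁₂, hg']
  have b₀ : (act E (S.p₀ ≫ S.d₀₁)).obj V = e₀ := by rw [act_comp_obj, k₀₁, kf]
  have b₁ : (act E (S.p₀ ≫ S.d₁₂)).obj V = e₁ := by rw [act_comp_obj, k₁₂, kf']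
  have b₂ : (act E (S.p₁ ≫ S.d₁₂)).obj V = e₂ := by rw [act_comp_obj, k₁₂, kg']
  rw [pairCell_eq S.d₀₁ Z V h₀₁ k₀₁ rfl S.p₁_d₀₁ hf hg kf kg a₀ a₁ b₀ b₁,
    pairCell_eq S.d₁₂ Z V h₁₂ k₁₂ rfl rfl hf' hg' kf' kg' a₁ a₂ b₁ b₂,
    pairCell_eq S.d₀₂ Z V h₀₂ k₀₂ S.p₀_d₀₂ S.p₁_d₀₂ hf'' hg'' kf'' kg'' a₀ a₂ b₀ b₂,
    pairCell_comp]

/-- The functor induced on codescent categories by fixing an object in the second factor of a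
product. -/
def leftData (D : Jᵒᵖ ⥤ Cat.{u, u}) {E : Jᵒᵖ ⥤ Cat.{u, u}} (e : E.obj (op j₀)) :
    CodescentData D j₀ (CodescentCat (prodDiagram D E) j₀) where
  functor :=
    { obj := fun c => pairObj D E c e
      map := fun m => pairMap m (𝟙 e)
      map_id := fun _ => rfl
      map_comp := fun m n => by rw [pairMap_comp, Category.comp_id] }
  -- The second coordinate is `e` made degenerate along `j ⟶ j₀`; each of its points is again `e`.
  cell {j} f g z _ _ hf hg := pairCell f g z ((act E (S.isTerminal.from j)).obj e) hf hg
    (act_act_obj_of_isTerminal E _ f e) (act_act_obj_of_isTerminal E _ g e)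
  cell_self f z := pairCell_self _ _ _ _ _ _ _
  cell_comp f g h z := pairCell_comp _ _ _ _ _ _ _ _ _ _ _ _ _
  cell_naturality {j} f g _ _ m :=
    pairMap_comp_pairCell f g m (𝟙 ((act E (S.isTerminal.from j)).obj e)) _ _ _ _ _ _ _ _
      HEq.rfl HEq.rfl (act_map_id_heq E f (act_act_obj_of_isTerminal E _ f e))
      (act_map_id_heq E g (act_act_obj_of_isTerminal E _ g e))
  cell_map f g h z := pairCell_eq h z _ rfl (act_from_obj E _ h e) rfl rfl _ _ _ _ _ _ _ _

/-- The functor induced on codescent categories by fixing an object in the first factor of a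
product. -/
def rightData {D : Jᵒᵖ ⥤ Cat.{u, u}} (E : Jᵒᵖ ⥤ Cat.{u, u}) (c : D.obj (op j₀)) :
    CodescentData E j₀ (CodescentCat (prodDiagram D E) j₀) where
  functor :=
    { obj := fun e => pairObj D E c e
      map := fun n => pairMap (𝟙 c) n
      map_id := fun _ => rfl
      map_comp := fun m n => by rw [pairMap_comp, Category.comp_id] }
  cell {j} f g w _ _ kf kg := pairCell f g ((act D (S.isTerminal.from j)).obj c) w
    (act_act_obj_of_isTerminal D _ f c) (act_act_obj_of_isTerminal D _ g c) kf kg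
  cell_self f z := pairCell_self _ _ _ _ _ _ _
  cell_comp f g h z := pairCell_comp _ _ _ _ _ _ _ _ _ _ _ _ _
  cell_naturality {j} f g _ _ n :=
    pairMap_comp_pairCell f g (𝟙 ((act D (S.isTerminal.from j)).obj c)) n _ _ _ _ _ _ _ _
      (act_map_id_heq D f (act_act_obj_of_isTerminal D _ f c))
      (act_map_id_heq D g (act_act_obj_of_isTerminal D _ g c)) HEq.rfl HEq.rfl
  cell_map f g h w := pairCell_eq h _ w (act_from_obj D _ h c) rfl rfl rfl _ _ _ _ _ _ _ _

/-- The action of a morphism of the first factor on the codescent category of a product. -/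
def left {a a' : CodescentCat D j₀} (m : a ⟶ a') (b : CodescentCat E j₀) :
    pairObj D E a.as b.as ⟶ pairObj D E a'.as b.as :=
  (CodescentCat.desc (S.leftData D b.as)).map m

/-- The action of a morphism of the second factor on the codescent category of a product. -/
def right (a : CodescentCat D j₀) {b b' : CodescentCat E j₀} (n : b ⟶ b') :
    pairObj D E a.as b.as ⟶ pairObj D E a.as b'.as :=
  (CodescentCat.desc (S.rightData E a.as)).map n

theorem left_id (a : CodescentCat D j₀) (b : CodescentCat E j₀) : S.left (𝟙 a) b = 𝟙 _ :=
  (CodescentCat.desc (S.leftData D b.as)).map_id a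

theorem right_id (a : CodescentCat D j₀) (b : CodescentCat E j₀) : S.right a (𝟙 b) = 𝟙 _ :=
  (CodescentCat.desc (S.rightData E a.as)).map_id b

theorem left_comp {a a' a'' : CodescentCat D j₀} (m : a ⟶ a') (n : a' ⟶ a'')
    (b : CodescentCat E j₀) : S.left (m ≫ n) b = S.left m b ≫ S.left n b :=
  (CodescentCat.desc (S.leftData D b.as)).map_comp m n

theorem right_comp (a : CodescentCat D j₀) {b b' b'' : CodescentCat E j₀} (m : b ⟶ b')
    (n : b' ⟶ b'') : S.right a (m ≫ n) = S.right a m ≫ S.right a n :=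
  (CodescentCat.desc (S.rightData E a.as)).map_comp m n

/-- The triangle is `(s₁ z, s₀ w)`: its first edge is `z` paired with a degenerate edge, its second
a degenerate edge paired with `w`, and its long edge the diagonal `(z, w)`. -/
theorem left_cell_comp_right_cell (z : D.obj (op S.j₁)) (w : E.obj (op S.j₁)) :
    S.left ((CodescentCat.data D j₀).cell S.p₀ S.p₁ z rfl rfl) ⟨(act E S.p₀).obj w⟩ ≫
      S.right ⟨(act D S.p₁).obj z⟩ ((CodescentCat.data E j₀).cell S.p₀ S.p₁ w rfl rfl) =
      pairCell S.p₀ S.p₁ z w rfl rfl rfl rfl :=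
  S.triangle (Z := (act D S.s₁).obj z) (V := (act E S.s₀).obj w)
    (by rw [← act_comp_obj, S.d₀₁_s₁, act_id_obj])
    (by rw [← act_comp_obj, S.d₁₂_s₁, act_comp_obj])
    (by rw [← act_comp_obj, S.d₀₂_s₁, act_id_obj])
    (by rw [← act_comp_obj, S.d₀₁_s₀, act_comp_obj])
    (by rw [← act_comp_obj, S.d₁₂_s₀, act_id_obj])
    (by rw [← act_comp_obj, S.d₀₂_s₀, act_id_obj])
    rfl rfl (act_act_obj_of_isTerminal D S.isTerminal _ _)
    (act_act_obj_of_isTerminal D S.isTerminal _ _) rfl rfl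
    (act_act_obj_of_isTerminal E S.isTerminal _ _)
    (act_act_obj_of_isTerminal E S.isTerminal _ _) rfl rfl rfl rfl

/-- The other half of the square, with the same diagonal: exchanging the degeneracies exchanges the
order of the factors. -/
theorem right_cell_comp_left_cell (z : D.obj (op S.j₁)) (w : E.obj (op S.j₁)) :
    S.right ⟨(act D S.p₀).obj z⟩ ((CodescentCat.data E j₀).cell S.p₀ S.p₁ w rfl rfl) ≫
      S.left ((CodescentCat.data D j₀).cell S.p₀ S.p₁ z rfl rfl) ⟨(act E S.p₁).obj w⟩ =
      pairCell S.p₀ S.p₁ z w rfl rfl rfl rfl :=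
  S.triangle (Z := (act D S.s₀).obj z) (V := (act E S.s₁).obj w)
    (by rw [← act_comp_obj, S.d₀₁_s₀, act_comp_obj])
    (by rw [← act_comp_obj, S.d₁₂_s₀, act_id_obj])
    (by rw [← act_comp_obj, S.d₀₂_s₀, act_id_obj])
    (by rw [← act_comp_obj, S.d₀₁_s₁, act_id_obj])
    (by rw [← act_comp_obj, S.d₁₂_s₁, act_comp_obj])
    (by rw [← act_comp_obj, S.d₀₂_s₁, act_id_obj])
    (act_act_obj_of_isTerminal D S.isTerminal _ _)
    (act_act_obj_of_isTerminal D S.isTerminal _ _) rfl rfl rfl rfl rfl rfl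
    (act_act_obj_of_isTerminal E S.isTerminal _ _)
    (act_act_obj_of_isTerminal E S.isTerminal _ _) rfl rfl

/-- This makes `prodInv` a functor. If one of the two morphisms comes from the base, it is
naturality of cells; for two edges, both composites equal the diagonal. Interchange passes to
composites and to inverses. -/
theorem left_comp_right {a a' : CodescentCat D j₀} (m : a ⟶ a') {b b' : CodescentCat E j₀}
    (n : b ⟶ b') : S.left m b ≫ S.right a' n = S.right a n ≫ S.left m b' := by
  induction m using S.induction with
  | @base c c' m =>
    induction n using CodescentCat.induction with
    | base n =>
      change pairMap m (𝟙 _) ≫ pairMap (𝟙 _) n = pairMap (𝟙 _) n ≫ pairMap m (𝟙 _)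
      rw [pairMap_comp, pairMap_comp]
      simp only [Category.comp_id, Category.id_comp]
    | @cell j f g w =>
      -- `m` is made degenerate along `j ⟶ j₀`, so that it becomes a morphism of `D j` at which
      -- cells are natural.
      exact pairMap_comp_pairCell f g ((act D (S.isTerminal.from j)).map m) (𝟙 w)
        (act_act_obj_of_isTerminal D S.isTerminal _ _)
        (act_act_obj_of_isTerminal D S.isTerminal _ _)
        (act_act_obj_of_isTerminal D S.isTerminal _ _)
        (act_act_obj_of_isTerminal D S.isTerminal _ _) rfl rfl rfl rfl
        (act_act_map_of_isTerminal D _ f m) (act_act_map_of_isTerminal D _ g m)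
        (act_map_id_heq E f rfl) (act_map_id_heq E g rfl)
    | comp n n' hn hn' =>
      rw [right_comp, right_comp, reassoc_of% hn, hn', Category.assoc]
  | cell z =>
    induction n using S.induction with
    | base n =>
      exact (pairMap_comp_pairCell S.p₀ S.p₁ (𝟙 z) ((act E (S.isTerminal.from S.j₁)).map n)
        rfl rfl rfl rfl (act_act_obj_of_isTerminal E S.isTerminal _ _)
        (act_act_obj_of_isTerminal E S.isTerminal _ _)
        (act_act_obj_of_isTerminal E S.isTerminal _ _)
        (act_act_obj_of_isTerminal E S.isTerminal _ _)
        (act_map_id_heq D S.p₀ rfl) (act_map_id_heq D S.p₁ rfl)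
        (act_act_map_of_isTerminal E _ _ n) (act_act_map_of_isTerminal E _ _ n)).symm
    | cell w =>
      exact (S.left_cell_comp_right_cell z w).trans (S.right_cell_comp_left_cell z w).symm
    | comp n n' hn hn' =>
      rw [right_comp, right_comp, reassoc_of% hn, hn', Category.assoc]
    | inv n n' h h' hn =>
      have e := S.right_comp ((CodescentCat.data D j₀).functor.obj ((act D S.p₀).obj z)) n' n
      have e' := S.right_comp ((CodescentCat.data D j₀).functor.obj ((act D S.p₁).obj z)) n n'
      rw [h', right_id] at e
      rw [h, right_id] at e'
      rw [← Category.id_comp (S.left _ _), e, Category.assoc, Category.assoc, ← reassoc_of% hn,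
        ← e', Category.comp_id]
  | comp m m' hm hm' =>
    rw [left_comp, left_comp, Category.assoc, hm', reassoc_of% hm]
  | inv m m' h h' hm =>
    have e := S.left_comp m' m b
    have e' := S.left_comp m m' b'
    rw [h', left_id] at e
    rw [h, left_id] at e'
    rw [← Category.comp_id (S.right _ n), e', ← reassoc_of% hm, ← reassoc_of% e]

end SimplicialFrame

end Frame

end WeightedColimits

/-! ### Preservation of finite products -/

namespace WeightedColimits

section Sifted

variable {J : Type} [Category.{0} J] {j₀ : J} {D E : Jᵒᵖ ⥤ Cat.{u, u}}

/-- A degenerate cell is pulled back from `j₀`, where both arrows become the identity because `j₀`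
is terminal. -/
theorem cell_act_from_eq_id (T : IsTerminal j₀) {j : J} (f g : j₀ ⟶ j) (c : D.obj (op j₀))
    (hf : (act D f).obj ((act D (T.from j)).obj c) = c)
    (hg : (act D g).obj ((act D (T.from j)).obj c) = c) :
    (CodescentCat.data D j₀).cell f g ((act D (T.from j)).obj c) hf hg = 𝟙 _ := by
  rw [(CodescentCat.data D j₀).cell_eq_cell (T.from j) c rfl (T.hom_ext _ (𝟙 j₀))
    (T.hom_ext _ (𝟙 j₀)) hf hg (act_id_obj D c) (act_id_obj D c), CodescentData.cell_self_eq]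

namespace SimplicialFrame

variable (S : SimplicialFrame j₀)

variable (D E j₀) in
/-- The functor between codescent categories induced by the first projection. -/
abbrev codescentFst : CodescentCat (prodDiagram D E) j₀ ⥤ CodescentCat D j₀ :=
  ((codescentFunctor j₀).map (prodDiagramFst D E)).toFunctor

variable (D E j₀) in
/-- The functor between codescent categories induced by the second projection. -/
abbrev codescentSnd : CodescentCat (prodDiagram D E) j₀ ⥤ CodescentCat E j₀ :=
  ((codescentFunctor j₀).map (prodDiagramSnd D E)).toFunctor

theorem codescentFst_map_left {a a' : CodescentCat D j₀} (m : a ⟶ a') (b : CodescentCat E j₀) :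
    (codescentFst j₀ D E).map (S.left m b) = m := by
  induction m using CodescentCat.induction with
  | base m => rfl
  | cell f g z => rfl
  | comp m n hm hn => rw [left_comp, Functor.map_comp, hm, hn]; rfl

theorem codescentSnd_map_right (a : CodescentCat D j₀) {b b' : CodescentCat E j₀} (n : b ⟶ b') :
    (codescentSnd j₀ D E).map (S.right a n) = n := by
  induction n using CodescentCat.induction with
  | base m => rfl
  | cell f g z => rfl
  | comp m n hm hn => rw [right_comp, Functor.map_comp, hm, hn]; rfl

theorem codescentFst_map_right (a : CodescentCat D j₀) {b b' : CodescentCat E j₀} (n : b ⟶ b') :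
    (codescentFst j₀ D E).map (S.right a n) = 𝟙 a := by
  induction n using CodescentCat.induction with
  | base m => rfl
  | cell f g z => exact cell_act_from_eq_id S.isTerminal f g a.as _ _
  | comp m n hm hn => rw [right_comp, Functor.map_comp, hm, hn]; exact Category.comp_id _

theorem codescentSnd_map_left {a a' : CodescentCat D j₀} (m : a ⟶ a') (b : CodescentCat E j₀) :
    (codescentSnd j₀ D E).map (S.left m b) = 𝟙 b := by
  induction m using CodescentCat.induction with
  | base m => rfl
  | cell f g z => exact cell_act_from_eq_id S.isTerminal f g b.as _ _
  | comp m n hm hn => rw [left_comp, Functor.map_comp, hm, hn]; exact Category.comp_id _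

variable (D E) in
/-- The inverse of the comparison functor between the codescent category of a product and the
product of the codescent categories. -/
def prodInv : CodescentCat D j₀ × CodescentCat E j₀ ⥤ CodescentCat (prodDiagram D E) j₀ where
  obj a := pairObj D E a.1.as a.2.as
  map {a a'} m := S.left m.1 a.2 ≫ S.right a'.1 m.2
  map_id a := by
    rw [prod_id_fst, prod_id_snd, left_id, right_id, Category.comp_id]
  map_comp {a a' a''} m n := by
    rw [prod_comp_fst, prod_comp_snd, left_comp, right_comp, Category.assoc, Category.assoc,
      reassoc_of% S.left_comp_right n.1 m.2]

theorem prodInv_comp_codescentFst :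
    S.prodInv D E ⋙ codescentFst j₀ D E = CategoryTheory.Prod.fst _ _ := by
  refine CategoryTheory.Functor.ext (fun _ => rfl) (fun a a' m => ?_)
  refine Eq.trans ?_ (eq_eqToHom_conj _ _ _)
  change (codescentFst j₀ D E).map (S.left m.1 a.2 ≫ S.right a'.1 m.2) = m.1
  rw [Functor.map_comp, codescentFst_map_left, codescentFst_map_right]
  exact Category.comp_id _

theorem prodInv_comp_codescentSnd :
    S.prodInv D E ⋙ codescentSnd j₀ D E = CategoryTheory.Prod.snd _ _ := by
  refine CategoryTheory.Functor.ext (fun _ => rfl) (fun a a' m => ?_)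
  refine Eq.trans ?_ (eq_eqToHom_conj _ _ _)
  change (codescentSnd j₀ D E).map (S.left m.1 a.2 ≫ S.right a'.1 m.2) = m.2
  rw [Functor.map_comp, codescentSnd_map_left, codescentSnd_map_right]
  exact Category.id_comp _

/-- By `S.hom_ext` it suffices to compare edge cells, and the diagonal edge is the composite of its
two lifts. -/
theorem prod'_comp_prodInv :
    (codescentFst j₀ D E).prod' (codescentSnd j₀ D E) ⋙ S.prodInv D E = 𝟭 _ := by
  refine S.hom_ext (fun _ => rfl) (fun {c c'} m => ?_) (fun z => ?_)
  · refine Eq.trans ?_ (eq_eqToHom_conj _ _ _)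
    change pairMap m.1 (𝟙 c.2) ≫ pairMap (𝟙 c'.1) m.2 = pairMap m.1 m.2
    rw [pairMap_comp, Category.comp_id, Category.id_comp]
  · refine Eq.trans ?_ (eq_eqToHom_conj _ _ _)
    exact S.left_cell_comp_right_cell z.1 z.2

variable (D E) in
/-- Codescent categories preserve binary products. -/
def isLimitBinaryFanCodescentFunctor :
    IsLimit (BinaryFan.mk ((codescentFunctor j₀).map (prodDiagramFst D E))
      ((codescentFunctor j₀).map (prodDiagramSnd D E))) :=
  BinaryFan.isLimitMk
    (fun s => (s.fst.toFunctor.prod' s.snd.toFunctor ⋙ S.prodInv D E).toCatHom)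
    (fun s => Cat.ext (congrArg (s.fst.toFunctor.prod' s.snd.toFunctor ⋙ ·)
      S.prodInv_comp_codescentFst))
    (fun s => Cat.ext (congrArg (s.fst.toFunctor.prod' s.snd.toFunctor ⋙ ·)
      S.prodInv_comp_codescentSnd))
    (fun s m h₁ h₂ => by
      rw [← h₁, ← h₂]
      exact Cat.ext (congrArg (m.toFunctor ⋙ ·) S.prod'_comp_prodInv).symm)

include S in
theorem preservesBinaryProducts :
    PreservesLimitsOfShape (Discrete WalkingPair) (codescentFunctor.{u} j₀) where
  preservesLimit {K} := by
    have : PreservesLimit (pair (K.obj ⟨.left⟩) (K.obj ⟨.right⟩)) (codescentFunctor.{u} j₀) :=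
      preservesLimit_of_preserves_limit_cone (isLimitProdDiagram _ _)
        ((isLimitMapConeBinaryFanEquiv _ _ _).symm (S.isLimitBinaryFanCodescentFunctor _ _))
    exact preservesLimit_of_iso_diagram _ (diagramIsoPair K).symm

end SimplicialFrame

variable (J) in
/-- The constant diagram at the one-object category. -/
abbrev unitDiagram : Jᵒᵖ ⥤ Cat.{u, u} :=
  (Functor.const _).obj (Cat.of (Discrete PUnit.{u + 1}))

variable (J) in
/-- The constant diagram at the one-object category is terminal. -/
def isTerminalUnitDiagram : IsTerminal (unitDiagram.{u} J) :=
  IsTerminal.ofUniqueHom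
    (fun _ => { app := fun _ => (Functor.star _).toCatHom, naturality := fun _ _ _ => rfl })
    (fun _ _ => rfl)

/-- Each object of the constant diagram is degenerate, so every generating cell is an identity. -/
theorem codescentCat_unitDiagram_hom_eq (T : IsTerminal j₀)
    {a b : CodescentCat (unitDiagram.{u} J) j₀} (m : a ⟶ b) :
    m = eqToHom (CodescentCat.ext (Subsingleton.elim (α := Discrete PUnit) _ _)) := by
  induction m using CodescentCat.induction with
  | @base c c' m =>
    obtain rfl : c = c' := Subsingleton.elim (α := Discrete PUnit) _ _
    obtain rfl : m = 𝟙 c := Discrete.instSubsingletonDiscreteHom (α := PUnit) c c |>.elim _ _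
    exact (CodescentCat.data (unitDiagram.{u} J) j₀).functor.map_id c
  | cell f g z => exact cell_act_from_eq_id (D := unitDiagram.{u} J) T f g z rfl rfl
  | comp m n hm hn => exact (congrArg₂ _ hm hn).trans (eqToHom_trans _ _)

/-- The codescent category of the terminal diagram is terminal. -/
def isTerminalCodescentCatUnitDiagram (T : IsTerminal j₀) :
    IsTerminal ((codescentFunctor.{u} j₀).obj (unitDiagram J)) :=
  IsTerminal.ofUniqueHom
    (fun _ => ((Functor.const _).obj (show CodescentCat (unitDiagram.{u} J) j₀ from
      ⟨⟨PUnit.unit⟩⟩)).toCatHom)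
    (fun C m => by
      refine Cat.ext (CategoryTheory.Functor.ext (fun _ => rfl) (fun a b f => ?_))
      exact (codescentCat_unitDiagram_hom_eq T _).trans
        (codescentCat_unitDiagram_hom_eq T _).symm)

theorem preservesTerminal_codescentFunctor (T : IsTerminal j₀) :
    PreservesLimit (Functor.empty.{0} _) (codescentFunctor.{u} j₀) :=
  preservesLimit_of_preserves_limit_cone (isTerminalUnitDiagram J)
    ((isLimitMapConeEmptyConeEquiv _ _).symm (isTerminalCodescentCatUnitDiagram T))

theorem SimplicialFrame.preservesFiniteProducts (S : SimplicialFrame j₀) :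
    PreservesFiniteProducts (codescentFunctor.{u} j₀) := by
  have := preservesTerminal_codescentFunctor.{u} S.isTerminal
  have := preservesLimitsOfShape_pempty_of_preservesTerminal (codescentFunctor.{u} j₀)
  have := S.preservesBinaryProducts.{u}
  exact PreservesFiniteProducts.of_preserves_binary_and_terminal _

end Sifted

end WeightedColimits

open WeightedColimits in
/-- Reflexive codescent objects are sifted flexible colimits. -/
theorem mainTheorem3 :
    WeightedColimits.IsSifted WeightedColimits.reflexiveCodescentWeight.{u} ∧
      WeightedColimits.IsFlexible WeightedColimits.reflexiveCodescentWeight.{u} := by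
  have h := isIndiscretelyRepresentedBy_reflexiveCodescentPoint.{u}
  have := h.isThin
  exact ⟨⟨weightedColimitFunctor h, truncatedSimplicialFrame.preservesFiniteProducts⟩,
    isFlexible_of_bijective h.bijective⟩
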